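/- Let $M$ be a smooth (Hausdorff, second countable) manifold with a smooth foliation $\mathcal F$ and a bundle-like Riemannian metric: the metric induces Riemannian metrics on the local quotients of $\mathcal F$ for which the local submersions defining $\mathcal F$ are Riemannian submersions. Let $\nabla$ be the Levi-Civita connection of $M$, let $\mathbf V$ and $\mathbf H$ be the orthogonal projections of $TM$ onto $T\mathcal F$ and $T\mathcal F^\perp$, and let $$\mathring\nabla_E F=\mathbf V\nabla_E(\mathbf V F)+\mathbf H\nabla_E(\mathbf H F)$$ be the adapted connection, with torsion $\mathring T(E,F)=\mathring\nabla_EF-\mathring\nabla_FE-[E,F]$ and curvature $\mathring R(E,F)=[\mathring\nabla_E,\mathring\nabla_F]-\mathring\nabla_{[E,F]}$. Denote by $|\mathring T_p|$ and $|\mathring R_p|$ their operator norms at $p$, i.e. the least $c\ge0$ with $|\mathring T(u,v)|\le c|u||v|$, respectively $|\mathring R(u,v)w|\le c|u||v||w|$, for all $u,v,w\in T_pM$. Let $a\le b$ and let $\gamma:[a,b]\to M$ be a leafwise geodesic, i.e. a smooth $\mathring\nabla$-geodesic contained in some leaf of $\mathcal F$. Let $X$ be an adapted Jacobi field along $\gamma$,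 i.e. a smooth vector field along $\gamma$ such that $$\mathring\nabla_{\dot\gamma}\mathring\nabla_{\dot\gamma}X-\mathring R(\dot\gamma,X)\dot\gamma-\mathring\nabla_{\dot\gamma}(\mathring T(\dot\gamma,X))=0 ,\qquad \mathring\nabla_{\dot\gamma(a)}X-\mathring T(\dot\gamma(a),X(a))\in T_{\gamma(a)}\mathcal F ,$$ and put $Y=\mathring\nabla_{\dot\gamma}X-\mathring T(\dot\gamma,X)$. Then the maximum $$C=\max_{a\le t\le b}\max\left\{3,\;2|\mathring T_{\gamma(t)}|^2|\dot\gamma(t)|^2+1+|\mathring R_{\gamma(t)}|^2|\dot\gamma(t)|^4\right\}$$ exists, and $$|X(b)|^2+|Y(b)|^2\le e^{C(b-a)}\left(|X(a)|^2+|Y(a)|^2\right).$$ -/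

import Mathlib

open Set Bundle Filter
open scoped Manifold ContDiff Topology

noncomputable section

set_option linter.unusedSectionVars false

section LeviCivita

variable {E : Type*} [NormedAddCommGroup E] [NormedSpace ℝ E] [FiniteDimensional ℝ E]
  {M : Type*} [TopologicalSpace M] [ChartedSpace E M] [IsManifold 𝓘(ℝ, E) ∞ M]
  [RiemannianBundle (fun x : M => TangentSpace 𝓘(ℝ, E) x)]

/-- The right-hand side of the Koszul formula for `⟨∇_X Y, Z⟩`. -/
def koszul (X Y Z : ∀ x : M, TangentSpace 𝓘(ℝ, E) x) (x : M) : ℝ :=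
  (1 / 2) *
    (mvfderiv 𝓘(ℝ, E) (fun y => inner ℝ (Y y) (Z y)) x (X x)
      + mvfderiv 𝓘(ℝ, E) (fun y => inner ℝ (Z y) (X y)) x (Y x)
      - mvfderiv 𝓘(ℝ, E) (fun y => inner ℝ (X y) (Y y)) x (Z x)
      + inner ℝ (VectorField.mlieBracket 𝓘(ℝ, E) X Y x) (Z x)
      - inner ℝ (VectorField.mlieBracket 𝓘(ℝ, E) X Z x) (Y x)
      - inner ℝ (VectorField.mlieBracket 𝓘(ℝ, E) Y Z x) (X x))

variable [IsContMDiffRiemannianBundle 𝓘(ℝ, E) ∞ E (fun x : M => TangentSpace 𝓘(ℝ, E) x)]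

variable {x : M} {X Y Z : ∀ x : M, TangentSpace 𝓘(ℝ, E) x}

theorem mdifferentiableAt_inner (hX : MDiffAt (T% X) x) (hY : MDiffAt (T% Y) x) :
    MDiffAt (fun y => inner ℝ (X y) (Y y)) x :=
  MDifferentiableAt.inner_bundle (IB := 𝓘(ℝ, E)) (F := E)
    (E := fun x : M => TangentSpace 𝓘(ℝ, E) x) (b := fun y => y) hX hY

theorem koszul_tensorial_left (hY : MDiffAt (T% Y) x) (hZ : MDiffAt (T% Z) x) :
    TensorialAt 𝓘(ℝ, E) E (fun X => koszul X Y Z x) x where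
  smul {f σ} hf hX := by
    have := FiniteDimensional.complete ℝ E
    simp [koszul, mvfderiv_fun_mul hf (mdifferentiableAt_inner hX hY), mvfderiv_fun_mul hf (mdifferentiableAt_inner hZ hX),
      VectorField.mlieBracket_smul_left hf hX, inner_smul_left, inner_smul_right, inner_add_left,
      real_inner_comm (σ x) (Z x)]
    ring
  add hX hX' := by
    have := FiniteDimensional.complete ℝ E
    simp [koszul, inner_add_left, inner_add_right, mvfderiv_fun_add (mdifferentiableAt_inner hX hY) (mdifferentiableAt_inner hX' hY),
      mvfderiv_fun_add (mdifferentiableAt_inner hZ hX) (mdifferentiableAt_inner hZ hX'),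
      VectorField.mlieBracket_add_left hX hX']
    ring

theorem koszul_tensorial_right (hX : MDiffAt (T% X) x) (hY : MDiffAt (T% Y) x) :
    TensorialAt 𝓘(ℝ, E) E (fun Z => koszul X Y Z x) x where
  smul {f σ} hf hZ := by
    have := FiniteDimensional.complete ℝ E
    simp [koszul, mvfderiv_fun_mul hf (mdifferentiableAt_inner hY hZ), mvfderiv_fun_mul hf (mdifferentiableAt_inner hZ hX),
      VectorField.mlieBracket_smul_right hf hZ, inner_smul_left, inner_smul_right, inner_add_left,
      real_inner_comm (σ x) (Y x)]
    ring
  add hZ hZ' := by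
    have := FiniteDimensional.complete ℝ E
    simp [koszul, inner_add_left, inner_add_right, mvfderiv_fun_add (mdifferentiableAt_inner hY hZ) (mdifferentiableAt_inner hY hZ'),
      mvfderiv_fun_add (mdifferentiableAt_inner hZ hX) (mdifferentiableAt_inner hZ' hX),
      VectorField.mlieBracket_add_right hZ hZ']
    ring

theorem koszul_add (hY : MDiffAt (T% Y) x) (hX : MDiffAt (T% X) x) (hZ : MDiffAt (T% Z) x) 
  {Y' : ∀ x : M, TangentSpace 𝓘(ℝ, E) x} (hY' : MDiffAt (T% Y') x) :
    koszul X (Y + Y') Z x = koszul X Y Z x + koszul X Y' Z x := by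
    have := FiniteDimensional.complete ℝ E
    simp [koszul, inner_add_left, inner_add_right, mvfderiv_fun_add (mdifferentiableAt_inner hX hY) (mdifferentiableAt_inner hX hY'),
      mvfderiv_fun_add (mdifferentiableAt_inner hY hZ) (mdifferentiableAt_inner hY' hZ),
      VectorField.mlieBracket_add_left hY hY', VectorField.mlieBracket_add_right hY hY']
    ring

theorem koszul_leibniz (hY : MDiffAt (T% Y) x) (hX : MDiffAt (T% X) x) (hZ : MDiffAt (T% Z) x) 
  {f : M → ℝ} (hf : MDiffAt f x) :
    koszul X (f • Y) Z x = f x * koszul X Y Z x + mvfderiv 𝓘(ℝ, E) f x (X x) * inner ℝ (Y x) (Z x) := by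
    have := FiniteDimensional.complete ℝ E
    simp [koszul, inner_add_left, inner_smul_left, inner_smul_right, mvfderiv_fun_mul hf (mdifferentiableAt_inner hX hY),
      mvfderiv_fun_mul hf (mdifferentiableAt_inner hY hZ),
      VectorField.mlieBracket_smul_left hf hY, VectorField.mlieBracket_smul_right hf hY, real_inner_comm (X x) (Y x)]
    ring

open scoped Classical in
/-- The bilinear form `(X, Z) ↦ ⟨∇_X Y, Z⟩` on the tangent space at `x`, given by the Koszul
formula (with the value `0` when `Y` is not differentiable at `x`). -/
def koszulForm (Y : ∀ x : M, TangentSpace 𝓘(ℝ, E) x) (x : M) :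
    TangentSpace 𝓘(ℝ, E) x →L[ℝ] TangentSpace 𝓘(ℝ, E) x →L[ℝ] ℝ :=
  if hY : MDiffAt (T% Y) x then
    TensorialAt.mkHom₂ (fun X Z => koszul X Y Z x) x
      (fun _ hZ => koszul_tensorial_left hY hZ) (fun _ hX => koszul_tensorial_right hX hY)
  else 0

theorem koszulForm_apply (hX : MDiffAt (T% X) x) (hY : MDiffAt (T% Y) x) (hZ : MDiffAt (T% Z) x) :
    koszulForm Y x (X x) (Z x) = koszul X Y Z x := by
  rw [koszulForm, dif_pos hY]
  exact TensorialAt.mkHom₂_apply _ _ hX hZ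

instance instFiniteDimensionalTangentSpace (x : M) :
    FiniteDimensional ℝ (TangentSpace 𝓘(ℝ, E) x) :=
  inferInstanceAs (FiniteDimensional ℝ E)


/-- The Levi-Civita connection. -/
def leviCivita : CovariantDerivative 𝓘(ℝ, E) E (fun x : M => TangentSpace 𝓘(ℝ, E) x) where
  toFun Y x := LinearMap.toContinuousLinearMap
    { toFun := fun v => (InnerProductSpace.toDual ℝ (TangentSpace 𝓘(ℝ, E) x)).symm (koszulForm Y x v)
      map_add' := by simp
      map_smul' := by simp }
  isCovariantDerivativeOnUniv :=
    { add := by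
        intro Y Y' x hY hY' _
        ext v
        refine ext_inner_right ℝ fun w => ?_
        have hv := FiberBundle.mdifferentiableAt_extend 𝓘(ℝ, E) E v
        have hw := FiberBundle.mdifferentiableAt_extend 𝓘(ℝ, E) E w
        have h1 := koszulForm_apply hv hY hw
        have h2 := koszulForm_apply hv hY' hw
        have h3 := koszulForm_apply hv (mdifferentiableAt_add_section hY hY') hw
        rw [koszul_add hY hv hw hY', ← h1, ← h2] at h3
        simpa [inner_add_left] using h3
      leibniz := by
        intro Y f x hY hf _
        ext v
        refine ext_inner_right ℝ fun w => ?_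
        have hv := FiberBundle.mdifferentiableAt_extend 𝓘(ℝ, E) E v
        have hw := FiberBundle.mdifferentiableAt_extend 𝓘(ℝ, E) E w
        have h1 := koszulForm_apply hv hY hw
        have h3 := koszulForm_apply hv (hf.smul_section hY) hw
        rw [koszul_leibniz hY hv hw hf, ← h1] at h3
        simpa [inner_add_left, inner_smul_left] using h3 }

theorem leviCivita_inner (hX : MDiffAt (T% X) x) (hY : MDiffAt (T% Y) x) (hZ : MDiffAt (T% Z) x) :
    inner ℝ (leviCivita Y x (X x)) (Z x) = koszul X Y Z x := by
  rw [← koszulForm_apply hX hY hZ]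
  simp [leviCivita]

theorem leviCivita_metric (hX : MDiffAt (T% X) x) (hY : MDiffAt (T% Y) x)
    (hZ : MDiffAt (T% Z) x) :
    mvfderiv 𝓘(ℝ, E) (fun y => inner ℝ (Y y) (Z y)) x (X x)
      = inner ℝ (leviCivita Y x (X x)) (Z x) + inner ℝ (Y x) (leviCivita Z x (X x)) := by
  rw [real_inner_comm _ (Y x), leviCivita_inner hX hY hZ, leviCivita_inner hX hZ hY]
  simp only [koszul, VectorField.mlieBracket_swap_apply (V := Z) (W := Y), inner_neg_left,
    fun y => real_inner_comm (Z y) (X y), fun y => real_inner_comm (Y y) (X y),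
    fun y => real_inner_comm (Z y) (Y y)]
  ring

theorem leviCivita_torsion_eq_zero [CompleteSpace E] :
    (leviCivita (E := E) (M := M)).torsion = 0 := by
  rw [CovariantDerivative.torsion_eq_zero_iff]
  intro X Y x hX hY
  refine ext_inner_right ℝ fun w => ?_
  have hw := FiberBundle.mdifferentiableAt_extend 𝓘(ℝ, E) E w
  have h1 := leviCivita_inner hX hY hw
  have h2 := leviCivita_inner hY hX hw
  simp only [FiberBundle.extend_apply_self] at h1 h2
  rw [inner_sub_left, h1, h2]
  simp only [koszul, VectorField.mlieBracket_swap_apply (V := Y) (W := X), inner_neg_left,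
    fun y => real_inner_comm (Y y) (X y), fun y => real_inner_comm (FiberBundle.extend E w y) (X y),
    fun y => real_inner_comm (Y y) (FiberBundle.extend E w y), FiberBundle.extend_apply_self]
  ring

/-- Orthogonal projections to single differentiable vector fields are differentiable. -/
theorem mdifferentiableAt_starProjection_singleton (hX : MDiffAt (T% X) x) (hY : MDiffAt (T% Y) x)
    (h0 : X x ≠ 0) :
    MDiffAt (T% (fun y => (ℝ ∙ X y).starProjection (Y y))) x := by
  have h (y : M) : (ℝ ∙ X y).starProjection (Y y) =
      (inner ℝ (X y) (Y y) * (inner ℝ (X y) (X y))⁻¹) • X y := by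
    rw [Submodule.starProjection_singleton, ← real_inner_self_eq_norm_sq, div_eq_mul_inv]
    rfl
  simp_rw [h]
  refine MDifferentiableAt.smul_section ((mdifferentiableAt_inner hX hY).mul ?_) hX
  exact DifferentiableAt.comp_mdifferentiableAt
    (differentiableAt_inv (inner_self_ne_zero.2 h0)) (mdifferentiableAt_inner hX hX)

theorem mdifferentiableAt_gramSchmidt {k : ℕ} {w : Fin k → ∀ x : M, TangentSpace 𝓘(ℝ, E) x}
    (hw : ∀ i, MDiffAt (T% (w i)) x) (hli : LinearIndependent ℝ (fun i => w i x)) (i : Fin k) :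
    MDiffAt (T% (fun y => InnerProductSpace.gramSchmidt ℝ (fun j => w j y) i)) x := by
  induction i using WellFoundedLT.induction with
  | ind i ih =>
    simp_rw [InnerProductSpace.gramSchmidt_def ℝ _ i]
    refine mdifferentiableAt_sub_section (hw i) (MDifferentiableAt.sum_section fun j hj => ?_)
    exact mdifferentiableAt_starProjection_singleton (ih j (Finset.mem_Iio.1 hj)) (hw i)
      (InnerProductSpace.gramSchmidt_ne_zero j hli)

theorem mdifferentiableAt_starProjection_span {k : ℕ}
    {w : Fin k → ∀ x : M, TangentSpace 𝓘(ℝ, E) x}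
    (hw : ∀ i, MDiffAt (T% (w i)) x) (hli : LinearIndependent ℝ (fun i => w i x))
    (hX : MDiffAt (T% X) x) :
    MDiffAt (T% (fun y => (Submodule.span ℝ (range fun i => w i y)).starProjection (X y))) x := by
  have h (y : M) : (Submodule.span ℝ (range fun i => w i y)).starProjection (X y) =
      ∑ i, (ℝ ∙ InnerProductSpace.gramSchmidt ℝ (fun j => w j y) i).starProjection (X y) := by
    have key := InnerProductSpace.span_gramSchmidt ℝ (fun j => w j y)
    apply Submodule.eq_starProjection_of_mem_orthogonal
    · rw [← key]
      refine Submodule.sum_mem _ fun i _ => ?_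
      exact Submodule.span_mono (by simp) (Submodule.coe_mem _)
    · rw [← key, Submodule.mem_orthogonal']
      intro u hu
      induction hu using Submodule.span_induction with
      | mem u hu =>
        obtain ⟨i, rfl⟩ := hu
        rw [inner_sub_left, sum_inner, Finset.sum_eq_single i]
        · rw [← inner_sub_left]
          exact Submodule.starProjection_inner_eq_zero _ _ (Submodule.mem_span_singleton_self _)
        · intro j _ hj
          rw [Submodule.starProjection_singleton, inner_smul_left,
            InnerProductSpace.gramSchmidt_orthogonal ℝ _ hj, mul_zero]
        · simp
      | zero => simp
      | add u v _ _ hu hv => rw [inner_add_right, hu, hv, add_zero]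
      | smul c u _ hu => rw [inner_smul_right, hu, mul_zero]
  simp_rw [h]
  exact MDifferentiableAt.sum_section fun i _ => mdifferentiableAt_starProjection_singleton
    (mdifferentiableAt_gramSchmidt hw hli i) hX (InnerProductSpace.gramSchmidt_ne_zero i hli)

end LeviCivita

section Foliation

/-- A smooth foliation of codimension `n'` and dimension `n''` on `M`, given by a covering of `M` by
foliation charts `φ = (π, ·)` onto products `B' × B''` with `B''` connected, such that
the submersions `π` onto the local quotients form a defining cocycle: on overlaps they differ by
smooth elementary holonomy transformations. -/
structure Foliation (E : Type*) [NormedAddCommGroup E] [NormedSpace ℝ E]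
    (M : Type*) [TopologicalSpace M] [ChartedSpace E M] (n' n'' : ℕ) where
  charts : Set (OpenPartialHomeomorph M (EuclideanSpace ℝ (Fin n') × EuclideanSpace ℝ (Fin n'')))
  smooth : ∀ φ ∈ charts, ContMDiffOn 𝓘(ℝ, E)
    𝓘(ℝ, EuclideanSpace ℝ (Fin n') × EuclideanSpace ℝ (Fin n'')) ∞ φ φ.source
  smooth_symm : ∀ φ ∈ charts, ContMDiffOn
    𝓘(ℝ, EuclideanSpace ℝ (Fin n') × EuclideanSpace ℝ (Fin n'')) 𝓘(ℝ, E) ∞ φ.symm φ.target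
  target_eq : ∀ φ ∈ charts, ∃ (B' : Set (EuclideanSpace ℝ (Fin n')))
    (B'' : Set (EuclideanSpace ℝ (Fin n''))),
    IsOpen B' ∧ IsOpen B'' ∧ IsConnected B'' ∧ φ.target = B' ×ˢ B''
  cover : ∀ x : M, ∃ φ ∈ charts, x ∈ φ.source
  holonomy : ∀ φ ∈ charts, ∀ ψ ∈ charts,
    ∃ h : EuclideanSpace ℝ (Fin n') → EuclideanSpace ℝ (Fin n'),
      ContDiffOn ℝ ∞ h ((fun x => (φ x).1) '' (φ.source ∩ ψ.source)) ∧
      ∀ x ∈ φ.source ∩ ψ.source, h (φ x).1 = (ψ x).1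

namespace Foliation

variable {E : Type*} [NormedAddCommGroup E] [NormedSpace ℝ E]
  {M : Type*} [TopologicalSpace M] [ChartedSpace E M] {n' n'' : ℕ}

/-- Two points lie in a common plaque, i.e. in a common fiber of a distinguished submersion. -/
def SamePlaque (F : Foliation E M n' n'') (x y : M) : Prop :=
  ∃ φ ∈ F.charts, x ∈ φ.source ∧ y ∈ φ.source ∧ (φ x).1 = (φ y).1

/-- The leaf through `x`: all points that are joined to `x` by a finite chain of plaques. -/
def leaf (F : Foliation E M n' n'') (x : M) : Set M :=
  {y | Relation.EqvGen F.SamePlaque x y}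

/-- The space of vectors at `x` tangent to the leaves (the vertical vectors), i.e. those killed by
the differentials of the distinguished submersions defined near `x`. -/
def tangent (F : Foliation E M n' n'') (x : M) : Submodule ℝ (TangentSpace 𝓘(ℝ, E) x) :=
  ⨅ φ ∈ F.charts, ⨅ _ : x ∈ φ.source,
    (mfderiv 𝓘(ℝ, E) 𝓘(ℝ, EuclideanSpace ℝ (Fin n')) (fun y => (φ y).1) x).ker

section aux

variable {F : Foliation E M n' n''}
  {φ : OpenPartialHomeomorph M (EuclideanSpace ℝ (Fin n') × EuclideanSpace ℝ (Fin n''))}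
  {x : M}

theorem mdifferentiable (hφ : φ ∈ F.charts) :
    φ.MDifferentiable 𝓘(ℝ, E) 𝓘(ℝ, EuclideanSpace ℝ (Fin n') × EuclideanSpace ℝ (Fin n'')) :=
  ⟨(F.smooth φ hφ).mdifferentiableOn (by simp), (F.smooth_symm φ hφ).mdifferentiableOn (by simp)⟩

theorem hasMFDerivAt_fst (hφ : φ ∈ F.charts) (hx : x ∈ φ.source) :
    HasMFDerivAt 𝓘(ℝ, E) 𝓘(ℝ, EuclideanSpace ℝ (Fin n')) (fun y => (φ y).1) x
      ((ContinuousLinearMap.fst ℝ (EuclideanSpace ℝ (Fin n')) (EuclideanSpace ℝ (Fin n''))).comp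
        (mfderiv 𝓘(ℝ, E) 𝓘(ℝ, EuclideanSpace ℝ (Fin n') × EuclideanSpace ℝ (Fin n'')) φ x)) :=
  HasMFDerivAt.comp x (g := Prod.fst) (I'' := 𝓘(ℝ, EuclideanSpace ℝ (Fin n')))
    (ContinuousLinearMap.fst ℝ (EuclideanSpace ℝ (Fin n'))
      (EuclideanSpace ℝ (Fin n''))).hasFDerivAt.hasMFDerivAt
    ((mdifferentiable hφ).mdifferentiableAt hx).hasMFDerivAt

theorem tangent_eq (hφ : φ ∈ F.charts) (hx : x ∈ φ.source) :
    F.tangent x =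
      (mfderiv 𝓘(ℝ, E) 𝓘(ℝ, EuclideanSpace ℝ (Fin n')) (fun y => (φ y).1) x).ker := by
  refine le_antisymm (iInf₂_le_of_le φ hφ (iInf_le _ hx)) ?_
  refine le_iInf₂ fun ψ hψ => le_iInf fun hxψ => ?_
  obtain ⟨h, hh, hcomp⟩ := F.holonomy φ hφ ψ hψ
  have hopen : IsOpen ((fun x => (φ x).1) '' (φ.source ∩ ψ.source)) := by
    have := isOpenMap_fst _ (φ.isOpen_image_of_subset_source
      (φ.open_source.inter ψ.open_source) inter_subset_left)
    rwa [image_image] at this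
  have hd : DifferentiableAt ℝ h (φ x).1 :=
    (hh.contDiffAt (hopen.mem_nhds ⟨x, ⟨hx, hxψ⟩, rfl⟩)).differentiableAt (by simp)
  have h1 := hasMFDerivAt_fst hφ hx
  have h2 : HasMFDerivAt 𝓘(ℝ, E) 𝓘(ℝ, EuclideanSpace ℝ (Fin n')) (fun y => (ψ y).1) x
      ((fderiv ℝ h (φ x).1).comp
        (mfderiv 𝓘(ℝ, E) 𝓘(ℝ, EuclideanSpace ℝ (Fin n')) (fun y => (φ y).1) x)) := by
    have := HasMFDerivAt.comp x (g := h) (f := fun y => (φ y).1)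
      hd.hasFDerivAt.hasMFDerivAt h1.mdifferentiableAt.hasMFDerivAt
    refine this.congr_of_eventuallyEq ?_
    filter_upwards [(φ.open_source.inter ψ.open_source).mem_nhds ⟨hx, hxψ⟩] with y hy
    exact (hcomp y hy).symm
  intro v hv
  rw [LinearMap.mem_ker] at hv ⊢
  rw [h2.mfderiv]
  change fderiv ℝ h (φ x).1 (mfderiv 𝓘(ℝ, E) 𝓘(ℝ, EuclideanSpace ℝ (Fin n')) (fun y => (φ y).1) x v) = 0
  have hv' : (mfderiv 𝓘(ℝ, E) 𝓘(ℝ, EuclideanSpace ℝ (Fin n')) (fun y => (φ y).1) x v) = 0 := hv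
  rw [hv']
  exact map_zero _

/-- The vertical local frame of a foliation chart. -/
def vertFrame (φ : OpenPartialHomeomorph M (EuclideanSpace ℝ (Fin n') × EuclideanSpace ℝ (Fin n'')))
    (i : Fin n'') (y : M) : TangentSpace 𝓘(ℝ, E) y :=
  VectorField.mpullback 𝓘(ℝ, E) 𝓘(ℝ, EuclideanSpace ℝ (Fin n') × EuclideanSpace ℝ (Fin n'')) φ
    (fun _ => ((0, EuclideanSpace.single i 1) :
      EuclideanSpace ℝ (Fin n') × EuclideanSpace ℝ (Fin n''))) y

theorem mdifferentiableAt_vertFrame [CompleteSpace E] [IsManifold 𝓘(ℝ, E) ∞ M] (hφ : φ ∈ F.charts) (hx : x ∈ φ.source) (i : Fin n'') :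
    MDiffAt (T% (fun y => vertFrame (E := E) φ i y)) x := by
  refine MDifferentiableAt.mpullback_vectorField (n := ∞) ?_ ?_ ?_ (by norm_cast)
  · exact (contMDiffAt_vectorSpace_iff_contDiffAt (n := 1)
      (V := fun _ => ((0, EuclideanSpace.single i 1) :
        EuclideanSpace ℝ (Fin n') × EuclideanSpace ℝ (Fin n''))).2
      contDiffAt_const).mdifferentiableAt one_ne_zero
  · exact (F.smooth φ hφ).contMDiffAt (φ.open_source.mem_nhds hx)
  · exact ⟨(mdifferentiable hφ).mfderiv hx, rfl⟩

/-- The differential of a foliation chart. -/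
def chartDeriv
    (φ : OpenPartialHomeomorph M (EuclideanSpace ℝ (Fin n') × EuclideanSpace ℝ (Fin n''))) (x : M) :
    TangentSpace 𝓘(ℝ, E) x →L[ℝ] EuclideanSpace ℝ (Fin n') × EuclideanSpace ℝ (Fin n'') :=
  mfderiv 𝓘(ℝ, E) 𝓘(ℝ, EuclideanSpace ℝ (Fin n') × EuclideanSpace ℝ (Fin n'')) φ x

theorem chartDeriv_injective (hφ : φ ∈ F.charts) (hx : x ∈ φ.source) :
    Function.Injective (chartDeriv (E := E) φ x) :=
  ((mdifferentiable hφ).mfderiv hx).injective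

theorem chartDeriv_vertFrame (hφ : φ ∈ F.charts) (hx : x ∈ φ.source) (i : Fin n'') :
    chartDeriv φ x (vertFrame (E := E) φ i x) = (0, EuclideanSpace.single i 1) := by
  have hinv : (mfderiv 𝓘(ℝ, E) 𝓘(ℝ, EuclideanSpace ℝ (Fin n') × EuclideanSpace ℝ (Fin n''))
    φ x).IsInvertible := ⟨(mdifferentiable hφ).mfderiv hx, rfl⟩
  exact hinv.self_apply_inverse _

theorem tangent_eq_span (hφ : φ ∈ F.charts) (hx : x ∈ φ.source) :
    F.tangent x = Submodule.span ℝ (range fun i => vertFrame (E := E) φ i x) := by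
  rw [tangent_eq hφ hx, (hasMFDerivAt_fst hφ hx).mfderiv]
  apply le_antisymm
  · intro v hv
    have hv1 : (chartDeriv φ x v).1 = 0 := hv
    have hsum : v = ∑ i, (chartDeriv φ x v).2 i • vertFrame φ i x := by
      apply chartDeriv_injective hφ hx
      rw [map_sum]
      simp_rw [map_smul, chartDeriv_vertFrame hφ hx]
      refine Prod.ext ?_ ?_
      · rw [hv1, Prod.fst_sum]
        simp
      · rw [Prod.snd_sum]
        ext j
        simp [Finset.sum_apply, Pi.single_apply]
    rw [hsum]
    exact Submodule.sum_mem _ fun i _ => Submodule.smul_mem _ _ (Submodule.subset_span ⟨i, rfl⟩)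
  · rw [Submodule.span_le]
    rintro _ ⟨i, rfl⟩
    exact congrArg Prod.fst (chartDeriv_vertFrame hφ hx i)

theorem linearIndependent_vertFrame (hφ : φ ∈ F.charts) (hx : x ∈ φ.source) :
    LinearIndependent ℝ (fun i => vertFrame (E := E) φ i x) := by
  rw [Fintype.linearIndependent_iff]
  intro c hc i
  have h := congrArg (chartDeriv (E := E) φ x) hc
  rw [map_sum, map_zero] at h
  simp_rw [map_smul, chartDeriv_vertFrame hφ hx] at h
  have h2 := congrArg (fun p : EuclideanSpace ℝ (Fin n') × EuclideanSpace ℝ (Fin n'') => p.2 i) h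
  simpa [Prod.snd_sum, Finset.sum_apply, Pi.single_apply] using h2

end aux

variable [FiniteDimensional ℝ E] [IsManifold 𝓘(ℝ, E) ∞ M]
  [RiemannianBundle (fun x : M => TangentSpace 𝓘(ℝ, E) x)]

/-- The orthogonal projection onto the vertical vectors. -/
def vert (F : Foliation E M n' n'') (x : M) :
    TangentSpace 𝓘(ℝ, E) x →L[ℝ] TangentSpace 𝓘(ℝ, E) x :=
  (F.tangent x).starProjection

/-- The orthogonal projection onto the horizontal vectors. -/
def horiz (F : Foliation E M n' n'') (x : M) :
    TangentSpace 𝓘(ℝ, E) x →L[ℝ] TangentSpace 𝓘(ℝ, E) x :=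
  (F.tangent x)ᗮ.starProjection

variable [IsContMDiffRiemannianBundle 𝓘(ℝ, E) ∞ E (fun x : M => TangentSpace 𝓘(ℝ, E) x)]

theorem mdifferentiableAt_vert (F : Foliation E M n' n'') {x : M}
    {X : ∀ x : M, TangentSpace 𝓘(ℝ, E) x} (hX : MDiffAt (T% X) x) :
    MDiffAt (T% (fun y => F.vert y (X y))) x := by
  have := FiniteDimensional.complete ℝ E
  obtain ⟨φ, hφ, hx⟩ := F.cover x
  refine (mdifferentiableAt_starProjection_span (w := fun i => vertFrame (E := E) φ i)
    (mdifferentiableAt_vertFrame hφ hx) (linearIndependent_vertFrame hφ hx)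
    hX).congr_of_eventuallyEq ?_
  filter_upwards [φ.open_source.mem_nhds hx] with y hy
  simp only [vert, tangent_eq_span hφ hy]

theorem mdifferentiableAt_horiz (F : Foliation E M n' n'') {x : M}
    {X : ∀ x : M, TangentSpace 𝓘(ℝ, E) x} (hX : MDiffAt (T% X) x) :
    MDiffAt (T% (fun y => F.horiz y (X y))) x := by
  simp only [horiz, Submodule.starProjection_orthogonal_val]
  exact mdifferentiableAt_sub_section hX (F.mdifferentiableAt_vert hX)

/-- The adapted connection `E, X ↦ V ∇_E (V X) + H ∇_E (H X)`, where `∇` is the Levi-Civita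
connection and `V`, `H` are the projections onto vertical and horizontal vectors. -/
def adapted (F : Foliation E M n' n'') :
    CovariantDerivative 𝓘(ℝ, E) E (fun x : M => TangentSpace 𝓘(ℝ, E) x) where
  toFun X x :=
    (F.vert x).comp (leviCivita (fun y => F.vert y (X y)) x)
      + (F.horiz x).comp (leviCivita (fun y => F.horiz y (X y)) x)
  isCovariantDerivativeOnUniv :=
    { add := by
        intro X X' x hX hX' _
        have h1 : (fun y => F.vert y ((X + X') y)) =
            (fun y => F.vert y (X y)) + (fun y => F.vert y (X' y)) := by
          funext y; simp
        have h2 : (fun y => F.horiz y ((X + X') y)) =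
            (fun y => F.horiz y (X y)) + (fun y => F.horiz y (X' y)) := by
          funext y; simp
        rw [h1, h2, leviCivita.isCovariantDerivativeOnUniv.add (F.mdifferentiableAt_vert hX)
            (F.mdifferentiableAt_vert hX'),
          leviCivita.isCovariantDerivativeOnUniv.add (F.mdifferentiableAt_horiz hX)
            (F.mdifferentiableAt_horiz hX')]
        ext v
        simp
        abel
      leibniz := by
        intro X f x hX hf _
        have h1 : (fun y => F.vert y ((f • X) y)) = f • (fun y => F.vert y (X y)) := by
          funext y; simp
        have h2 : (fun y => F.horiz y ((f • X) y)) = f • (fun y => F.horiz y (X y)) := by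
          funext y; simp
        rw [h1, h2, leviCivita.isCovariantDerivativeOnUniv.leibniz (F.mdifferentiableAt_vert hX) hf,
          leviCivita.isCovariantDerivativeOnUniv.leibniz (F.mdifferentiableAt_horiz hX) hf]
        have h3 : F.vert x (F.vert x (X x)) + F.horiz x (F.horiz x (X x)) = X x := by
          have h4 : (F.tangent x).starProjection ((F.tangent x).starProjection (X x))
              = (F.tangent x).starProjection (X x) :=
            Submodule.starProjection_eq_self_iff.2 (Submodule.coe_mem _)
          simp [vert, horiz, h4]
        ext v
        simp only [add_apply, ContinuousLinearMap.comp_apply,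
          smul_apply, ContinuousLinearMap.smulRight_apply, map_add, map_smul]
        conv_rhs => rw [← h3]
        module }

/-- The torsion tensor `T(X, Y) = ∇_X Y - ∇_Y X - [X, Y]` of the adapted connection. -/
def torsion (F : Foliation E M n' n'') (x : M) :
    TangentSpace 𝓘(ℝ, E) x →L[ℝ] TangentSpace 𝓘(ℝ, E) x →L[ℝ] TangentSpace 𝓘(ℝ, E) x :=
  have := FiniteDimensional.complete ℝ E
  F.adapted.torsion x

/-- The curvature `R(u, v) w` of the adapted connection, where
`R(U, V) W = ∇_U ∇_V W - ∇_V ∇_U W - ∇_[U, V] W`, computed with extensions of the given tangent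
vectors to vector fields that are smooth near `x`. -/
def curvature (F : Foliation E M n' n'') (x : M) (u v w : TangentSpace 𝓘(ℝ, E) x) :
    TangentSpace 𝓘(ℝ, E) x :=
  let U := FiberBundle.extend E u
  let V := FiberBundle.extend E v
  let W := FiberBundle.extend E w
  F.adapted (fun y => F.adapted W y (V y)) x u
    - F.adapted (fun y => F.adapted W y (U y)) x v
    - F.adapted W x (VectorField.mlieBracket 𝓘(ℝ, E) U V x)

/-- The operator norm of the torsion of the adapted connection at `x`. -/
def torsionNorm (F : Foliation E M n' n'') (x : M) : ℝ :=
  sInf {c : ℝ | 0 ≤ c ∧ ∀ u v : TangentSpace 𝓘(ℝ, E) x, ‖F.torsion x u v‖ ≤ c * ‖u‖ * ‖v‖}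

/-- The operator norm of the curvature of the adapted connection at `x`. -/
def curvatureNorm (F : Foliation E M n' n'') (x : M) : ℝ :=
  sInf {c : ℝ | 0 ≤ c ∧ ∀ u v w : TangentSpace 𝓘(ℝ, E) x,
    ‖F.curvature x u v w‖ ≤ c * ‖u‖ * ‖v‖ * ‖w‖}

/-- The metric of `M` is bundle-like: it induces Riemannian metrics on the local quotients such that
the distinguished submersions are Riemannian submersions. -/
def IsBundleLike (F : Foliation E M n' n'') : Prop :=
  ∀ φ ∈ F.charts,
    ∃ g : EuclideanSpace ℝ (Fin n') →
        EuclideanSpace ℝ (Fin n') →L[ℝ] EuclideanSpace ℝ (Fin n') →L[ℝ] ℝ,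
      ContDiffOn ℝ ∞ g ((fun x => (φ x).1) '' φ.source) ∧
      (∀ z ∈ (fun x => (φ x).1) '' φ.source,
        (∀ u v, g z u v = g z v u) ∧ ∀ u, u ≠ 0 → 0 < g z u u) ∧
      ∀ x ∈ φ.source, ∀ u ∈ (F.tangent x)ᗮ, ∀ v ∈ (F.tangent x)ᗮ,
        inner ℝ u v = g (φ x).1
          (mfderiv 𝓘(ℝ, E) 𝓘(ℝ, EuclideanSpace ℝ (Fin n')) (fun y => (φ y).1) x u)
          (mfderiv 𝓘(ℝ, E) 𝓘(ℝ, EuclideanSpace ℝ (Fin n')) (fun y => (φ y).1) x v)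

/-- The velocity of a curve `γ : [a, b] → M`. -/
def velocity (a b : ℝ) (γ : ℝ → M) (t : ℝ) : TangentSpace 𝓘(ℝ, E) (γ t) :=
  mfderivWithin 𝓘(ℝ, ℝ) 𝓘(ℝ, E) γ (Icc a b) t (1 : ℝ)

/-- The covariant derivative, with respect to the adapted connection, of a vector field `X` along
`γ : [a, b] → M`. In the local trivialization of `TM` at `γ t` write `X = ∑ ξⁱ eᵢ`, where the `eᵢ`
form a constant frame; then the covariant derivative is `∑ (ξⁱ)' eᵢ + ∑ ξⁱ ∇_γ' eᵢ`, and
`∑ ξⁱ(t) eᵢ` is the extension of `X t` to a field that is constant in the trivialization. -/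
def covDerivAlong (F : Foliation E M n' n'') (a b : ℝ) (γ : ℝ → M)
    (X : ∀ t, TangentSpace 𝓘(ℝ, E) (γ t)) (t : ℝ) : TangentSpace 𝓘(ℝ, E) (γ t) :=
  (trivializationAt E (fun x : M => TangentSpace 𝓘(ℝ, E) x) (γ t)).symm (γ t)
      (derivWithin (fun r =>
        (trivializationAt E (fun x : M => TangentSpace 𝓘(ℝ, E) x) (γ t) ⟨γ r, X r⟩).2)
        (Icc a b) t)
    + F.adapted (FiberBundle.extend E (X t)) (γ t) (velocity a b γ t)

/-- `γ : [a, b] → M` is a leafwise geodesic: a geodesic of the adapted connection that is contained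
in some leaf. -/
structure IsLeafwiseGeodesic (F : Foliation E M n' n'') (a b : ℝ) (γ : ℝ → M) : Prop where
  smooth : ContMDiffOn 𝓘(ℝ, ℝ) 𝓘(ℝ, E) ∞ γ (Icc a b)
  mem_leaf : ∃ p, ∀ t ∈ Icc a b, γ t ∈ F.leaf p
  geodesic : ∀ t ∈ Icc a b, F.covDerivAlong a b γ (velocity a b γ) t = 0

/-- The vector field `Y = ∇_γ' X - T(γ', X)` along `γ : [a, b] → M`. -/
def jacobiY (F : Foliation E M n' n'') (a b : ℝ) (γ : ℝ → M)
    (X : ∀ t, TangentSpace 𝓘(ℝ, E) (γ t)) (t : ℝ) : TangentSpace 𝓘(ℝ, E) (γ t) :=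
  F.covDerivAlong a b γ X t - F.torsion (γ t) (velocity a b γ t) (X t)

/-- `X` is an adapted Jacobi field along `γ : [a, b] → M`. -/
structure IsAdaptedJacobiField (F : Foliation E M n' n'') (a b : ℝ) (γ : ℝ → M)
    (X : ∀ t, TangentSpace 𝓘(ℝ, E) (γ t)) : Prop where
  smooth : ContMDiffOn 𝓘(ℝ, ℝ) 𝓘(ℝ, E).tangent ∞
    (fun t => (⟨γ t, X t⟩ : TangentBundle 𝓘(ℝ, E) M)) (Icc a b)
  jacobi : ∀ t ∈ Icc a b,
    F.covDerivAlong a b γ (F.covDerivAlong a b γ X) t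
      - F.curvature (γ t) (velocity a b γ t) (X t) (velocity a b γ t)
      - F.covDerivAlong a b γ (fun r => F.torsion (γ r) (velocity a b γ r) (X r)) t = 0
  vertical : F.jacobiY a b γ X a ∈ F.tangent (γ a)

end Foliation

end Foliation

end

/-! Put `h = |X|² + |Y|²`. The orthogonal projections are self-adjoint and the Levi-Civita
connection is metric, so the adapted connection is metric (`adapted_metric`), and along the curve
`h' = 2⟨X, ∇X⟩ + 2⟨Y, ∇Y⟩` (`hasDerivWithinAt_norm_sq_along`). By the definition of `Y`, `∇X = Y +
T(γ', X)`; the Jacobi equation regroups as `∇Y = R(γ', X)γ'` (`covDerivAlong_jacobiY`). The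
second-order equation has thus become a first-order linear system, and Cauchy–Schwarz with `2xy ≤ x²
+ y²` gives `h' ≤ (2|T|²|γ'|² + 1 + |R|²|γ'|⁴)|X|² + 3|Y|² ≤ C h` (`two_mul_inner_add_le`).
Grönwall's inequality (`le_exp_mul_of_hasDerivWithinAt_le`) finishes the estimate.

The longer part of the work is regularity. The maximum `C` exists by compactness of `[a, b]` once
the operator norms of torsion and curvature are continuous. For this, smooth orthonormal frames
(`exists_isOrthonormalFrameOn`) identify nearby tangent spaces isometrically with one Euclidean
space, where both tensors become multilinear maps with continuous coefficients. For the curvature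
this needs tensoriality in all three slots. The same frames express the covariant derivative along a
curve by one formula near each parameter, which yields smoothness of `∇X` and `Y`, additivity of the
derivative, and the product rule for `|X|²`. -/

noncomputable section

set_option linter.unusedSectionVars false

/-! ### Smooth vector fields and their commutators -/

section SmoothFields

variable {E : Type*} [NormedAddCommGroup E] [NormedSpace ℝ E] [FiniteDimensional ℝ E]
  {M : Type*} [TopologicalSpace M] [ChartedSpace E M] [IsManifold 𝓘(ℝ, E) ∞ M]
  {x : M} {X Y Z : ∀ x : M, TangentSpace 𝓘(ℝ, E) x}

theorem ContMDiffAt.eventually_mdifferentiableAt_section (hX : CMDiffAt ∞ (T% X) x) :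
    ∀ᶠ y in 𝓝 x, MDiffAt (T% X) y := by
  have h1 : CMDiffAt 1 (T% X) x := hX.of_le (by norm_cast)
  filter_upwards [(contMDiffAt_iff_contMDiffAt_nhds (by norm_num)).1 h1] with y hy
  exact hy.mdifferentiableAt one_ne_zero

theorem ContMDiffAt.mdifferentiableAt_section (hX : CMDiffAt ∞ (T% X) x) : MDiffAt (T% X) x :=
  hX.mdifferentiableAt (by simp)

theorem ContMDiffAt.mvfderiv_apply {f : M → ℝ} (hf : CMDiffAt ∞ f x) (hX : CMDiffAt ∞ (T% X) x) :
    CMDiffAt ∞ (fun y => mvfderiv 𝓘(ℝ, E) f y (X y)) x := by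
  have h := ContMDiffAt.clm_apply_of_inCoordinates (b₁ := fun y : M => y) (b₂ := f)
    (ϕ := fun y => mfderiv 𝓘(ℝ, E) 𝓘(ℝ, ℝ) f y) (v := X)
    (E₁ := fun y : M => TangentSpace 𝓘(ℝ, E) y) (E₂ := fun y : ℝ => TangentSpace 𝓘(ℝ, ℝ) y)
    (IM := 𝓘(ℝ, E))
    (IB₁ := 𝓘(ℝ, E)) (IB₂ := 𝓘(ℝ, ℝ)) (m₀ := x) (n := ∞) (F₁ := E) (F₂ := ℝ)
    (hf.mfderiv_const (m := ∞) (by simp)) hX hf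
  -- The tangent bundle of `ℝ` is trivialised by the identity, so the fibre component of `df(X)` is
  -- the function itself.
  rw [contMDiffAt_totalSpace] at h
  have h2 := h.2
  simp only [trivializationAt_model_space_apply] at h2
  exact h2

theorem ContMDiffAt.mlieBracket_section (hX : CMDiffAt ∞ (T% X) x) (hY : CMDiffAt ∞ (T% Y) x) :
    CMDiffAt ∞ (T% (VectorField.mlieBracket 𝓘(ℝ, E) X Y)) x := by
  have := FiniteDimensional.complete ℝ E
  have : IsManifold 𝓘(ℝ, E) (((⊤ : ℕ∞) : ℕ∞ω) + 1) M := by simpa using ‹IsManifold 𝓘(ℝ, E) ∞ M›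
  have : IsManifold 𝓘(ℝ, E) (minSmoothness ℝ 2) M := by
    rw [minSmoothness_of_isRCLikeNormedField]
    infer_instance
  have : IsManifold 𝓘(ℝ, E) (minSmoothness ℝ 3) M := by
    rw [minSmoothness_of_isRCLikeNormedField]
    exact .of_le (n := ∞) (by norm_cast)
  exact ContMDiffAt.mlieBracket_vectorField (m := ⊤) (n := ⊤) hX hY (by simp)


/-- The commutator of two vector fields acting on functions is their Lie bracket. -/
theorem mvfderiv_mvfderiv_sub_mvfderiv_mvfderiv {f : M → ℝ} (hf : CMDiffAt ∞ f x)
    (hX : CMDiffAt ∞ (T% X) x) (hY : CMDiffAt ∞ (T% Y) x) (hZ : CMDiffAt ∞ (T% Z) x)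
    (h0 : Z x ≠ 0) :
    mvfderiv 𝓘(ℝ, E) (fun y => mvfderiv 𝓘(ℝ, E) f y (Y y)) x (X x)
      - mvfderiv 𝓘(ℝ, E) (fun y => mvfderiv 𝓘(ℝ, E) f y (X y)) x (Y x)
      = mvfderiv 𝓘(ℝ, E) f x (VectorField.mlieBracket 𝓘(ℝ, E) X Y x) := by
  have := FiniteDimensional.complete ℝ E
  have : IsManifold 𝓘(ℝ, E) (minSmoothness ℝ 3) M := by
    rw [minSmoothness_of_isRCLikeNormedField]
    exact .of_le (n := ∞) (by norm_cast)
  have h2 : (2 : ℕ∞ω) ≤ ∞ := by norm_cast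
  have hmin : minSmoothness ℝ 2 = 2 := minSmoothness_of_isRCLikeNormedField
  have jac {W : ∀ x : M, TangentSpace 𝓘(ℝ, E) x} (hW : CMDiffAt ∞ (T% W) x) :=
    VectorField.leibniz_identity_mlieBracket_apply (hmin ▸ hX.of_le h2) (hmin ▸ hY.of_le h2)
      (hmin ▸ hW.of_le h2)
  have bracket_smul {V : ∀ x : M, TangentSpace 𝓘(ℝ, E) x} :
      VectorField.mlieBracket 𝓘(ℝ, E) V (f • Z) =ᶠ[𝓝 x]
        (fun y => mvfderiv 𝓘(ℝ, E) f y (V y)) • Z + f • VectorField.mlieBracket 𝓘(ℝ, E) V Z := by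
    have hf1 : CMDiffAt 1 f x := hf.of_le (by norm_cast)
    filter_upwards [hZ.eventually_mdifferentiableAt_section,
      (contMDiffAt_iff_contMDiffAt_nhds (by norm_num)).1 hf1] with y hy hfy
    exact VectorField.mlieBracket_smul_right (hfy.mdifferentiableAt one_ne_zero) hy
  have key {V W : ∀ x : M, TangentSpace 𝓘(ℝ, E) x} (hV : CMDiffAt ∞ (T% V) x)
      (hW : CMDiffAt ∞ (T% W) x) :
      VectorField.mlieBracket 𝓘(ℝ, E) V (VectorField.mlieBracket 𝓘(ℝ, E) W (f • Z)) x =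
        mvfderiv 𝓘(ℝ, E) (fun y => mvfderiv 𝓘(ℝ, E) f y (W y)) x (V x) • Z x
        + mvfderiv 𝓘(ℝ, E) f x (W x) • VectorField.mlieBracket 𝓘(ℝ, E) V Z x
        + (mvfderiv 𝓘(ℝ, E) f x (V x) • VectorField.mlieBracket 𝓘(ℝ, E) W Z x
          + f x • VectorField.mlieBracket 𝓘(ℝ, E) V (VectorField.mlieBracket 𝓘(ℝ, E) W Z) x) := by
    have hfd : MDiffAt f x := hf.mdifferentiableAt (by simp)
    have hfW : MDiffAt (fun y => mvfderiv 𝓘(ℝ, E) f y (W y)) x :=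
      (hf.mvfderiv_apply hW).mdifferentiableAt (by simp)
    have hWZ := (hW.mlieBracket_section hZ).mdifferentiableAt_section
    have hZd := hZ.mdifferentiableAt_section
    rw [EventuallyEq.rfl.mlieBracket_vectorField_eq bracket_smul,
      VectorField.mlieBracket_add_right (hfW.smul_section hZd) (hfd.smul_section hWZ),
      VectorField.mlieBracket_smul_right hfW hZd, VectorField.mlieBracket_smul_right hfd hWZ]
  have e1 := jac (hf.smul_section hZ)
  have e2 := jac hZ
  rw [key hX hY, key hY hX, bracket_smul.eq_of_nhds] at e1
  simp only [Pi.add_apply, Pi.smul_apply', e2] at e1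
  rw [← sub_eq_zero, ← smul_eq_zero_iff_left h0]
  rw [← sub_eq_zero] at e1
  rw [← e1]
  module

end SmoothFields

/-! ### Orthonormal frames and smoothness of the Levi-Civita connection -/

section SmoothMetric

variable {E : Type*} [NormedAddCommGroup E] [NormedSpace ℝ E] [FiniteDimensional ℝ E]
  {M : Type*} [TopologicalSpace M] [ChartedSpace E M] [IsManifold 𝓘(ℝ, E) ∞ M]
  [RiemannianBundle (fun x : M => TangentSpace 𝓘(ℝ, E) x)]
  [IsContMDiffRiemannianBundle 𝓘(ℝ, E) ∞ E (fun x : M => TangentSpace 𝓘(ℝ, E) x)]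
  {x : M} {X Y Z : ∀ x : M, TangentSpace 𝓘(ℝ, E) x}

theorem contMDiffAt_inner (hX : CMDiffAt ∞ (T% X) x) (hY : CMDiffAt ∞ (T% Y) x) :
    CMDiffAt ∞ (fun y => inner ℝ (X y) (Y y)) x :=
  ContMDiffAt.inner_bundle (IB := 𝓘(ℝ, E)) (F := E)
    (E := fun x : M => TangentSpace 𝓘(ℝ, E) x) (b := fun y => y) hX hY

theorem contMDiffAt_koszul (hX : CMDiffAt ∞ (T% X) x) (hY : CMDiffAt ∞ (T% Y) x)
    (hZ : CMDiffAt ∞ (T% Z) x) : CMDiffAt ∞ (koszul X Y Z) x := by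
  have h1 := (contMDiffAt_inner hY hZ).mvfderiv_apply hX
  have h2 := (contMDiffAt_inner hZ hX).mvfderiv_apply hY
  have h3 := (contMDiffAt_inner hX hY).mvfderiv_apply hZ
  have h4 := contMDiffAt_inner (hX.mlieBracket_section hY) hZ
  have h5 := contMDiffAt_inner (hX.mlieBracket_section hZ) hY
  have h6 := contMDiffAt_inner (hY.mlieBracket_section hZ) hX
  exact contMDiffAt_const.mul (((((h1.add h2).sub h3).add h4).sub h5).sub h6)

theorem contMDiffAt_starProjection_singleton (hX : CMDiffAt ∞ (T% X) x)
    (hY : CMDiffAt ∞ (T% Y) x) (h0 : X x ≠ 0) :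
    CMDiffAt ∞ (T% (fun y => (ℝ ∙ X y).starProjection (Y y))) x := by
  have h (y : M) : (ℝ ∙ X y).starProjection (Y y) =
      (inner ℝ (X y) (Y y) * (inner ℝ (X y) (X y))⁻¹) • X y := by
    rw [Submodule.starProjection_singleton, ← real_inner_self_eq_norm_sq, div_eq_mul_inv]
    rfl
  simp_rw [h]
  refine ContMDiffAt.smul_section ((contMDiffAt_inner hX hY).mul ?_) hX
  exact ContDiffAt.comp_contMDiffAt (f := fun y => inner ℝ (X y) (X y))
    (contDiffAt_inv ℝ (inner_self_ne_zero.2 h0)) (contMDiffAt_inner hX hX)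

theorem contMDiffAt_gramSchmidt {k : ℕ} {w : Fin k → ∀ x : M, TangentSpace 𝓘(ℝ, E) x}
    (hw : ∀ i, CMDiffAt ∞ (T% (w i)) x) (hli : LinearIndependent ℝ (fun i => w i x)) (i : Fin k) :
    CMDiffAt ∞ (T% (fun y => InnerProductSpace.gramSchmidt ℝ (fun j => w j y) i)) x := by
  induction i using WellFoundedLT.induction with
  | ind i ih =>
    simp_rw [InnerProductSpace.gramSchmidt_def ℝ _ i]
    refine (hw i).sub_section (ContMDiffAt.sum_section fun j hj => ?_)
    exact contMDiffAt_starProjection_singleton (ih j (Finset.mem_Iio.1 hj)) (hw i)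
      (InnerProductSpace.gramSchmidt_ne_zero j hli)

/-- The Gram–Schmidt vectors are pairwise orthogonal with the same span, so the residual is
orthogonal to each of them. A vanishing vector contributes zero, hence no independence is needed.
The right-hand side is explicit enough to be seen to vary smoothly with the base point. -/
theorem starProjection_span_eq_sum_gramSchmidt {V : Type*} [NormedAddCommGroup V]
    [InnerProductSpace ℝ V] [FiniteDimensional ℝ V] {k : ℕ} (w : Fin k → V) (v : V) :
    (Submodule.span ℝ (range w)).starProjection v =
      ∑ i, (ℝ ∙ InnerProductSpace.gramSchmidt ℝ w i).starProjection v := by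
  have key := InnerProductSpace.span_gramSchmidt ℝ w
  apply Submodule.eq_starProjection_of_mem_orthogonal
  · rw [← key]
    refine Submodule.sum_mem _ fun i _ => ?_
    exact Submodule.span_mono (by simp) (Submodule.coe_mem _)
  · rw [← key, Submodule.mem_orthogonal']
    intro u hu
    induction hu using Submodule.span_induction with
    | mem u hu =>
      obtain ⟨i, rfl⟩ := hu
      rw [inner_sub_left, sum_inner, Finset.sum_eq_single i]
      · rw [← inner_sub_left]
        exact Submodule.starProjection_inner_eq_zero _ _ (Submodule.mem_span_singleton_self _)
      · intro j _ hj
        rw [Submodule.starProjection_singleton, inner_smul_left,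
          InnerProductSpace.gramSchmidt_orthogonal ℝ _ hj, mul_zero]
      · simp
    | zero => simp
    | add u v _ _ hu hv => rw [inner_add_right, hu, hv, add_zero]
    | smul c u _ hu => rw [inner_smul_right, hu, mul_zero]

theorem contMDiffAt_starProjection_span {k : ℕ}
    {w : Fin k → ∀ x : M, TangentSpace 𝓘(ℝ, E) x}
    (hw : ∀ i, CMDiffAt ∞ (T% (w i)) x) (hli : LinearIndependent ℝ (fun i => w i x))
    (hX : CMDiffAt ∞ (T% X) x) :
    CMDiffAt ∞ (T% (fun y => (Submodule.span ℝ (range fun i => w i y)).starProjection (X y))) x := by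
  have h (y : M) : (Submodule.span ℝ (range fun i => w i y)).starProjection (X y) =
      ∑ i, (ℝ ∙ InnerProductSpace.gramSchmidt ℝ (fun j => w j y) i).starProjection (X y) :=
    starProjection_span_eq_sum_gramSchmidt _ _
  simp_rw [h]
  exact ContMDiffAt.sum_section fun i _ => contMDiffAt_starProjection_singleton
    (contMDiffAt_gramSchmidt hw hli i) hX (InnerProductSpace.gramSchmidt_ne_zero i hli)

/-- A smooth orthonormal frame of the tangent bundle on an open set. -/
structure IsOrthonormalFrameOn {ι : Type*} [Fintype ι] (s : ι → ∀ x : M, TangentSpace 𝓘(ℝ, E) x)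
    (U : Set M) : Prop where
  isOpen : IsOpen U
  smooth : ∀ x ∈ U, ∀ i, CMDiffAt ∞ (T% (s i)) x
  orthonormal : ∀ x ∈ U, Orthonormal ℝ (fun i => s i x)
  span_eq_top : ∀ x ∈ U, Submodule.span ℝ (range fun i => s i x) = ⊤

namespace IsOrthonormalFrameOn

variable {ι : Type*} [Fintype ι] {s : ι → ∀ x : M, TangentSpace 𝓘(ℝ, E) x} {U : Set M}

/-- The orthonormal basis of a tangent space given by an orthonormal frame. -/
def basis (hs : IsOrthonormalFrameOn s U) (hx : x ∈ U) :
    OrthonormalBasis ι ℝ (TangentSpace 𝓘(ℝ, E) x) :=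
  OrthonormalBasis.mk (hs.orthonormal x hx) (hs.span_eq_top x hx).ge

theorem basis_apply (hs : IsOrthonormalFrameOn s U) (hx : x ∈ U) (i : ι) :
    hs.basis hx i = s i x := by
  simp [basis]

theorem eq_sum (hs : IsOrthonormalFrameOn s U) (hx : x ∈ U) (v : TangentSpace 𝓘(ℝ, E) x) :
    v = ∑ i, inner ℝ (s i x) v • s i x := by
  have h := (hs.basis hx).sum_repr' v
  simp only [basis_apply] at h
  exact h.symm

end IsOrthonormalFrameOn

variable (E) in
-- Gram–Schmidt applied to a local frame of the tangent bundle; normalising keeps smoothness because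
-- independent vectors stay nonzero under orthogonalisation. Coordinates in such a frame are inner
-- products, so regularity questions become scalar ones.
theorem exists_isOrthonormalFrameOn (x : M) :
    ∃ (s : Fin (Module.finrank ℝ E) → ∀ x : M, TangentSpace 𝓘(ℝ, E) x) (U : Set M),
      x ∈ U ∧ IsOrthonormalFrameOn s U := by
  let e := trivializationAt E (fun x : M => TangentSpace 𝓘(ℝ, E) x) x
  let b := Module.finBasis ℝ E
  have he := e.isLocalFrameOn_localFrame_baseSet 𝓘(ℝ, E) ∞ b
  have hsm (i) {y : M} (hy : y ∈ e.baseSet) : CMDiffAt ∞ (T% (e.localFrame b i)) y :=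
    he.contMDiffAt e.open_baseSet hy i
  refine ⟨fun i y => InnerProductSpace.gramSchmidtNormed ℝ (fun j => e.localFrame b j y) i,
    e.baseSet, FiberBundle.mem_baseSet_trivializationAt' x, e.open_baseSet, ?_, ?_, ?_⟩
  · intro y hy i
    have hg := contMDiffAt_gramSchmidt (fun i => hsm i hy) (he.linearIndependent hy) i
    have hne := InnerProductSpace.gramSchmidt_ne_zero (𝕜 := ℝ) i (he.linearIndependent hy)
    have h2 : CMDiffAt ∞ (fun y => (Real.sqrt (inner ℝ
        (InnerProductSpace.gramSchmidt ℝ (fun j => e.localFrame b j y) i)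
        (InnerProductSpace.gramSchmidt ℝ (fun j => e.localFrame b j y) i)))⁻¹) y := by
      have hpos := real_inner_self_pos.2 hne
      exact ContDiffAt.comp_contMDiffAt (f := fun y => inner ℝ
          (InnerProductSpace.gramSchmidt ℝ (fun j => e.localFrame b j y) i)
          (InnerProductSpace.gramSchmidt ℝ (fun j => e.localFrame b j y) i))
        ((contDiffAt_inv ℝ (Real.sqrt_pos.2 hpos).ne').comp _ (Real.contDiffAt_sqrt hpos.ne'))
        (contMDiffAt_inner hg hg)
    refine (h2.smul_section hg).congr_of_eventuallyEq (Eventually.of_forall fun z => ?_)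
    simp [InnerProductSpace.gramSchmidtNormed]
  · intro y hy
    exact InnerProductSpace.gramSchmidtNormed_orthonormal (he.linearIndependent hy)
  · intro y hy
    rw [InnerProductSpace.span_gramSchmidtNormed_range, InnerProductSpace.span_gramSchmidt]
    exact top_le_iff.1 (he.generating hy)

/-- The components of `∇_X Y` in an orthonormal frame are Koszul expressions, which are smooth. -/
theorem contMDiffAt_leviCivita (hX : CMDiffAt ∞ (T% X) x) (hY : CMDiffAt ∞ (T% Y) x) :
    CMDiffAt ∞ (T% (fun y => leviCivita Y y (X y))) x := by
  obtain ⟨s, U, hxU, hs⟩ := exists_isOrthonormalFrameOn E x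
  refine (ContMDiffAt.sum_section (s := Finset.univ) (t := fun i y => koszul X Y (s i) y • s i y)
    fun i _ => (contMDiffAt_koszul hX hY (hs.smooth x hxU i)).smul_section
      (hs.smooth x hxU i)).congr_of_eventuallyEq ?_
  filter_upwards [hX.eventually_mdifferentiableAt_section,
    hY.eventually_mdifferentiableAt_section, hs.isOpen.mem_nhds hxU] with y hXy hYy hyU
  rw [TotalSpace.mk_inj, hs.eq_sum hyU (leviCivita Y y (X y))]
  refine Finset.sum_congr rfl fun i _ => ?_
  rw [real_inner_comm, leviCivita_inner hXy hYy (hs.smooth y hyU i).mdifferentiableAt_section]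

end SmoothMetric

/-! ### Smoothness and metric compatibility of the adapted connection -/

namespace Foliation

variable {E : Type*} [NormedAddCommGroup E] [NormedSpace ℝ E]
  {M : Type*} [TopologicalSpace M] [ChartedSpace E M] {n' n'' : ℕ}
  {F : Foliation E M n' n''} {x : M}

theorem contMDiffAt_vertFrame [CompleteSpace E] [IsManifold 𝓘(ℝ, E) ∞ M]
    {φ : OpenPartialHomeomorph M (EuclideanSpace ℝ (Fin n') × EuclideanSpace ℝ (Fin n''))}
    (hφ : φ ∈ F.charts) (hx : x ∈ φ.source) (i : Fin n'') :
    CMDiffAt ∞ (T% (fun y => vertFrame (E := E) φ i y)) x := by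
  refine ContMDiffAt.mpullback_vectorField_preimage (n := ∞) (m := ∞) ?_ ?_ ?_ (by simp)
  · exact (contMDiffAt_vectorSpace_iff_contDiffAt (n := ∞)
      (V := fun _ => ((0, EuclideanSpace.single i 1) :
        EuclideanSpace ℝ (Fin n') × EuclideanSpace ℝ (Fin n''))).2
      contDiffAt_const)
  · exact (F.smooth φ hφ).contMDiffAt (φ.open_source.mem_nhds hx)
  · exact ⟨(mdifferentiable hφ).mfderiv hx, rfl⟩

variable [FiniteDimensional ℝ E] [IsManifold 𝓘(ℝ, E) ∞ M]
  [RiemannianBundle (fun x : M => TangentSpace 𝓘(ℝ, E) x)]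
  [IsContMDiffRiemannianBundle 𝓘(ℝ, E) ∞ E (fun x : M => TangentSpace 𝓘(ℝ, E) x)]
  {X Y Z : ∀ x : M, TangentSpace 𝓘(ℝ, E) x}

theorem contMDiffAt_vert (F : Foliation E M n' n'') (hX : CMDiffAt ∞ (T% X) x) :
    CMDiffAt ∞ (T% (fun y => F.vert y (X y))) x := by
  have := FiniteDimensional.complete ℝ E
  obtain ⟨φ, hφ, hx⟩ := F.cover x
  refine (contMDiffAt_starProjection_span (w := fun i => vertFrame (E := E) φ i)
    (contMDiffAt_vertFrame hφ hx) (linearIndependent_vertFrame hφ hx)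
    hX).congr_of_eventuallyEq ?_
  filter_upwards [φ.open_source.mem_nhds hx] with y hy
  simp only [vert, tangent_eq_span hφ hy]

theorem contMDiffAt_horiz (F : Foliation E M n' n'') (hX : CMDiffAt ∞ (T% X) x) :
    CMDiffAt ∞ (T% (fun y => F.horiz y (X y))) x := by
  simp only [horiz, Submodule.starProjection_orthogonal_val]
  exact hX.sub_section (F.contMDiffAt_vert hX)

theorem contMDiffAt_adapted (F : Foliation E M n' n'') (hX : CMDiffAt ∞ (T% X) x)
    (hY : CMDiffAt ∞ (T% Y) x) :
    CMDiffAt ∞ (T% (fun y => F.adapted Y y (X y))) x :=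
  (F.contMDiffAt_vert (contMDiffAt_leviCivita hX (F.contMDiffAt_vert hY))).add_section
    (F.contMDiffAt_horiz (contMDiffAt_leviCivita hX (F.contMDiffAt_horiz hY)))

theorem contMDiffAt_torsion (F : Foliation E M n' n'') (hX : CMDiffAt ∞ (T% X) x)
    (hY : CMDiffAt ∞ (T% Y) x) :
    CMDiffAt ∞ (T% (fun y => F.torsion y (X y) (Y y))) x := by
  have := FiniteDimensional.complete ℝ E
  refine (((F.contMDiffAt_adapted hX hY).sub_section (F.contMDiffAt_adapted hY hX)).sub_section
    (hX.mlieBracket_section hY)).congr_of_eventuallyEq ?_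
  filter_upwards [hX.eventually_mdifferentiableAt_section,
    hY.eventually_mdifferentiableAt_section] with y hXy hYy
  rw [TotalSpace.mk_inj]
  exact F.adapted.torsion_apply hXy hYy

theorem inner_vert_left (F : Foliation E M n' n'') (u v : TangentSpace 𝓘(ℝ, E) x) :
    inner ℝ (F.vert x u) v = inner ℝ u (F.vert x v) :=
  Submodule.inner_starProjection_left_eq_right _ _ _

theorem inner_horiz_left (F : Foliation E M n' n'') (u v : TangentSpace 𝓘(ℝ, E) x) :
    inner ℝ (F.horiz x u) v = inner ℝ u (F.horiz x v) :=
  Submodule.inner_starProjection_left_eq_right _ _ _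

theorem inner_eq_vert_add_horiz (F : Foliation E M n' n'') (u v : TangentSpace 𝓘(ℝ, E) x) :
    inner ℝ u v = inner ℝ (F.vert x u) (F.vert x v) + inner ℝ (F.horiz x u) (F.horiz x v) := by
  have h1 : F.vert x (F.vert x v) = F.vert x v :=
    Submodule.starProjection_eq_self_iff.2 (Submodule.coe_mem _)
  have h2 : F.horiz x (F.horiz x v) = F.horiz x v :=
    Submodule.starProjection_eq_self_iff.2 (Submodule.coe_mem _)
  rw [inner_vert_left, inner_horiz_left, h1, h2, ← inner_add_right]
  simp [vert, horiz]

/-- The adapted connection is metric. -/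
theorem adapted_metric (F : Foliation E M n' n'') (hX : MDiffAt (T% X) x) (hY : MDiffAt (T% Y) x)
    (hZ : MDiffAt (T% Z) x) :
    mvfderiv 𝓘(ℝ, E) (fun y => inner ℝ (Y y) (Z y)) x (X x)
      = inner ℝ (F.adapted Y x (X x)) (Z x) + inner ℝ (Y x) (F.adapted Z x (X x)) := by
  simp_rw [F.inner_eq_vert_add_horiz (Y _) (Z _)]
  have hVY := F.mdifferentiableAt_vert hY
  have hVZ := F.mdifferentiableAt_vert hZ
  have hHY := F.mdifferentiableAt_horiz hY
  have hHZ := F.mdifferentiableAt_horiz hZ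
  rw [mvfderiv_fun_add (mdifferentiableAt_inner hVY hVZ) (mdifferentiableAt_inner hHY hHZ),
    add_apply, leviCivita_metric hX hVY hVZ, leviCivita_metric hX hHY hHZ]
  -- Self-adjointness moves the outer projections of the adapted connection onto the other factor,
  -- which matches the Levi-Civita product rules for the vertical and horizontal parts.
  simp only [adapted, add_apply, ContinuousLinearMap.comp_apply,
    inner_add_left, inner_add_right, ← inner_vert_left, ← inner_horiz_left]
  simp only [inner_vert_left, inner_horiz_left]
  ring

end Foliation

/-! ### Tensoriality on smooth fields -/

section SmoothTensorial

variable {E : Type*} [NormedAddCommGroup E] [NormedSpace ℝ E]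
  {M : Type*} [TopologicalSpace M] [ChartedSpace E M] [IsManifold 𝓘(ℝ, E) ∞ M]
  {A : Type*} [AddCommGroup A] [Module ℝ A] {x : M}

/-- An operation on vector fields is tensorial on fields that are smooth at `x`. -/
structure SmoothTensorialAt (Φ : (∀ x : M, TangentSpace 𝓘(ℝ, E) x) → A) (x : M) : Prop where
  smul : ∀ {f : M → ℝ} {X : ∀ x : M, TangentSpace 𝓘(ℝ, E) x}, CMDiffAt ∞ f x →
    CMDiffAt ∞ (T% X) x → Φ (f • X) = f x • Φ X
  add : ∀ {X Y : ∀ x : M, TangentSpace 𝓘(ℝ, E) x}, CMDiffAt ∞ (T% X) x →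
    CMDiffAt ∞ (T% Y) x → Φ (X + Y) = Φ X + Φ Y

namespace SmoothTensorialAt

variable {Φ : (∀ x : M, TangentSpace 𝓘(ℝ, E) x) → A} {X Y : ∀ x : M, TangentSpace 𝓘(ℝ, E) x}

/-- Multiplication by the indicator of the coincidence set makes the two fields equal everywhere.
That indicator is constantly `1` near `x`, hence smooth at `x`, so no bump function is needed. -/
theorem congr_of_eventuallyEq (hΦ : SmoothTensorialAt Φ x) (hX : CMDiffAt ∞ (T% X) x)
    (hY : CMDiffAt ∞ (T% Y) x) (h : ∀ᶠ y in 𝓝 x, X y = Y y) : Φ X = Φ Y := by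
  classical
  let ψ (y : M) : ℝ := if X y = Y y then 1 else 0
  have hψx : ψ x = 1 := by simp [ψ, h.self_of_nhds]
  have hψ : ψ • X = ψ • Y := by
    funext y
    by_cases hy : X y = Y y <;> simp [ψ, hy]
  have hψs : CMDiffAt ∞ ψ x :=
    (contMDiffAt_const (c := (1 : ℝ))).congr_of_eventuallyEq (h.mono fun y hy => by simp [ψ, hy])
  calc Φ X = Φ (ψ • X) := by simp [hΦ.smul hψs hX, hψx]
    _ = Φ (ψ • Y) := by rw [hψ]
    _ = Φ Y := by simp [hΦ.smul hψs hY, hψx]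

theorem zero (hΦ : SmoothTensorialAt Φ x) : Φ 0 = 0 := by
  have h := hΦ.smul (f := fun _ => 0) (X := 0) contMDiffAt_const
    (contMDiff_zeroSection ℝ (fun x : M => TangentSpace 𝓘(ℝ, E) x)).contMDiffAt
  simpa using h

theorem sum (hΦ : SmoothTensorialAt Φ x) {ι : Type*} (t : Finset ι)
    {σ : ι → ∀ x : M, TangentSpace 𝓘(ℝ, E) x} (hσ : ∀ i, CMDiffAt ∞ (T% (σ i)) x) :
    Φ (fun y => ∑ i ∈ t, σ i y) = ∑ i ∈ t, Φ (σ i) := by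
  classical
  induction t using Finset.induction_on with
  | empty => simpa using! hΦ.zero
  | insert i t hi ih =>
    simp only [Finset.sum_insert hi, ← ih]
    exact hΦ.add (hσ i) (ContMDiffAt.sum_section fun j _ => hσ j)

variable [FiniteDimensional ℝ E] [RiemannianBundle (fun x : M => TangentSpace 𝓘(ℝ, E) x)]
  [IsContMDiffRiemannianBundle 𝓘(ℝ, E) ∞ E (fun x : M => TangentSpace 𝓘(ℝ, E) x)]

/-- In particular `Φ X` depends on `X` only through its value at `x`: near `x` the field is a
combination of the frame with smooth coefficients, and these are pulled out of `Φ`. -/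
theorem eq_sum (hΦ : SmoothTensorialAt Φ x) {ι : Type*} [Fintype ι]
    {s : ι → ∀ x : M, TangentSpace 𝓘(ℝ, E) x} {U : Set M} (hs : IsOrthonormalFrameOn s U)
    (hx : x ∈ U) (hX : CMDiffAt ∞ (T% X) x) :
    Φ X = ∑ i, (inner ℝ (s i x) (X x) : ℝ) • Φ (s i) := by
  have hc (i : ι) := contMDiffAt_inner (hs.smooth x hx i) hX
  have hσ (i : ι) : CMDiffAt ∞ (T% ((fun y => (inner ℝ (s i y) (X y) : ℝ)) • s i)) x :=
    (hc i).smul_section (hs.smooth x hx i)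
  rw [hΦ.congr_of_eventuallyEq hX (ContMDiffAt.sum_section (s := Finset.univ) fun i _ => hσ i)
    (by filter_upwards [hs.isOpen.mem_nhds hx] with y hy using hs.eq_sum hy (X y)),
    hΦ.sum _ hσ]
  exact Finset.sum_congr rfl fun i _ => hΦ.smul (hc i) (hs.smooth x hx i)

end SmoothTensorialAt

end SmoothTensorial

/-! ### The curvature of the adapted connection is a tensor -/

namespace Foliation

variable {E : Type*} [NormedAddCommGroup E] [NormedSpace ℝ E] [FiniteDimensional ℝ E]
  {M : Type*} [TopologicalSpace M] [ChartedSpace E M] [IsManifold 𝓘(ℝ, E) ∞ M]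
  [RiemannianBundle (fun x : M => TangentSpace 𝓘(ℝ, E) x)]
  [IsContMDiffRiemannianBundle 𝓘(ℝ, E) ∞ E (fun x : M => TangentSpace 𝓘(ℝ, E) x)]
  {n' n'' : ℕ} {x : M} {U V W : ∀ x : M, TangentSpace 𝓘(ℝ, E) x}

theorem adapted_add (F : Foliation E M n' n'') (hU : MDiffAt (T% U) x) (hV : MDiffAt (T% V) x) :
    F.adapted (U + V) x = F.adapted U x + F.adapted V x :=
  F.adapted.isCovariantDerivativeOnUniv.add hU hV

theorem adapted_smul (F : Foliation E M n' n'') {f : M → ℝ} (hf : MDiffAt f x)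
    (hU : MDiffAt (T% U) x) (v : TangentSpace 𝓘(ℝ, E) x) :
    F.adapted (f • U) x v = f x • F.adapted U x v + mvfderiv 𝓘(ℝ, E) f x v • U x := by
  rw [F.adapted.isCovariantDerivativeOnUniv.leibniz hU hf]
  rfl

theorem adapted_congr (F : Foliation E M n' n'') (hU : MDiffAt (T% U) x) (hV : MDiffAt (T% V) x)
    (h : ∀ᶠ y in 𝓝 x, U y = V y) : F.adapted U x = F.adapted V x :=
  F.adapted.isCovariantDerivativeOnUniv.congr_of_eventuallyEq hU hV univ_mem h

/-- The curvature `∇_U ∇_V W - ∇_V ∇_U W - ∇_[U, V] W` of the adapted connection as an operation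
on vector fields. -/
def curvatureField (F : Foliation E M n' n'') (U V W : ∀ x : M, TangentSpace 𝓘(ℝ, E) x) (x : M) :
    TangentSpace 𝓘(ℝ, E) x :=
  F.adapted (fun y => F.adapted W y (V y)) x (U x)
    - F.adapted (fun y => F.adapted W y (U y)) x (V x)
    - F.adapted W x (VectorField.mlieBracket 𝓘(ℝ, E) U V x)

theorem curvature_eq_curvatureField (F : Foliation E M n' n'') (u v w : TangentSpace 𝓘(ℝ, E) x) :
    F.curvature x u v w = F.curvatureField (FiberBundle.extend E u) (FiberBundle.extend E v)
      (FiberBundle.extend E w) x := by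
  simp [curvature, curvatureField]

theorem contMDiffAt_curvatureField (F : Foliation E M n' n'') (hU : CMDiffAt ∞ (T% U) x)
    (hV : CMDiffAt ∞ (T% V) x) (hW : CMDiffAt ∞ (T% W) x) :
    CMDiffAt ∞ (T% (F.curvatureField U V W)) x :=
  ((F.contMDiffAt_adapted hU (F.contMDiffAt_adapted hV hW)).sub_section
    (F.contMDiffAt_adapted hV (F.contMDiffAt_adapted hU hW))).sub_section
    (F.contMDiffAt_adapted (hU.mlieBracket_section hV) hW)

theorem curvatureField_swap (F : Foliation E M n' n'') :
    F.curvatureField U V W x = - F.curvatureField V U W x := by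
  simp only [curvatureField, VectorField.mlieBracket_swap_apply (V := U) (W := V), map_neg]
  abel

/-- The derivative of `f` produced by `∇_V (f ∇_U W)` cancels the one in `[fU, V] = f[U, V] -
(Vf)U`. -/
theorem curvatureField_tensorial_left (F : Foliation E M n' n'')
    (hW : CMDiffAt ∞ (T% W) x) : SmoothTensorialAt (fun U => F.curvatureField U V W x) x where
  smul {f U} hf hU := by
    have := FiniteDimensional.complete ℝ E
    have h (y : M) : F.adapted W y ((f • U) y) = f y • F.adapted W y (U y) := by simp
    have h' : (fun y => F.adapted W y ((f • U) y)) = f • fun y => F.adapted W y (U y) := by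
      funext y; exact h y
    have hfd : MDiffAt f x := hf.mdifferentiableAt (by simp)
    simp only [curvatureField, h']
    rw [F.adapted_smul hfd (F.contMDiffAt_adapted hU hW).mdifferentiableAt_section,
      VectorField.mlieBracket_smul_left hfd hU.mdifferentiableAt_section]
    simp only [Pi.smul_apply', map_smul, map_add]
    module
  add {U U'} hU hU' := by
    have := FiniteDimensional.complete ℝ E
    have h' : (fun y => F.adapted W y ((U + U') y)) =
        (fun y => F.adapted W y (U y)) + fun y => F.adapted W y (U' y) := by
      funext y; simp
    simp only [curvatureField, h']
    rw [F.adapted_add (F.contMDiffAt_adapted hU hW).mdifferentiableAt_section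
        (F.contMDiffAt_adapted hU' hW).mdifferentiableAt_section,
      VectorField.mlieBracket_add_left hU.mdifferentiableAt_section hU'.mdifferentiableAt_section]
    simp only [Pi.add_apply, map_add, add_apply]
    abel

theorem curvatureField_tensorial_middle (F : Foliation E M n' n'')
    (hW : CMDiffAt ∞ (T% W) x) : SmoothTensorialAt (fun V => F.curvatureField U V W x) x where
  smul {f V} hf hV := by
    rw [F.curvatureField_swap, (F.curvatureField_tensorial_left hW).smul hf hV,
      F.curvatureField_swap (U := U), smul_neg]
  add {V V'} hV hV' := by
    rw [F.curvatureField_swap, (F.curvatureField_tensorial_left hW).add hV hV',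
      F.curvatureField_swap (U := U), F.curvatureField_swap (U := U) (V := V'), neg_add]

theorem adapted_adapted_add (F : Foliation E M n' n'') {W' : ∀ x : M, TangentSpace 𝓘(ℝ, E) x}
    (hU : CMDiffAt ∞ (T% U) x) (hW : CMDiffAt ∞ (T% W) x) (hW' : CMDiffAt ∞ (T% W') x) :
    F.adapted (fun y => F.adapted (W + W') y (U y)) x =
      F.adapted (fun y => F.adapted W y (U y)) x + F.adapted (fun y => F.adapted W' y (U y)) x := by
  have h1 := (F.contMDiffAt_adapted hU hW).mdifferentiableAt_section
  have h2 := (F.contMDiffAt_adapted hU hW').mdifferentiableAt_section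
  rw [← F.adapted_add h1 h2]
  refine F.adapted_congr (F.contMDiffAt_adapted hU (hW.add_section hW')).mdifferentiableAt_section
    (mdifferentiableAt_add_section h1 h2) ?_
  filter_upwards [hW.eventually_mdifferentiableAt_section,
    hW'.eventually_mdifferentiableAt_section] with y hy hy'
  simp [F.adapted_add hy hy']

theorem adapted_adapted_smul (F : Foliation E M n' n'') {f : M → ℝ} (hf : CMDiffAt ∞ f x)
    (hU : CMDiffAt ∞ (T% U) x) (hW : CMDiffAt ∞ (T% W) x) (v : TangentSpace 𝓘(ℝ, E) x) :
    F.adapted (fun y => F.adapted (f • W) y (U y)) x v =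
      f x • F.adapted (fun y => F.adapted W y (U y)) x v
        + mvfderiv 𝓘(ℝ, E) f x v • F.adapted W x (U x)
        + (mvfderiv 𝓘(ℝ, E) f x (U x) • F.adapted W x v
          + mvfderiv 𝓘(ℝ, E) (fun y => mvfderiv 𝓘(ℝ, E) f y (U y)) x v • W x) := by
  have hfd : MDiffAt f x := hf.mdifferentiableAt (by simp)
  have hg : MDiffAt (fun y => mvfderiv 𝓘(ℝ, E) f y (U y)) x :=
    (hf.mvfderiv_apply hU).mdifferentiableAt (by simp)
  have h1 := (F.contMDiffAt_adapted hU hW).mdifferentiableAt_section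
  have h2 := hW.mdifferentiableAt_section
  rw [← F.adapted_smul hfd h1, ← F.adapted_smul hg h2, ← add_apply,
    ← F.adapted_add (hfd.smul_section h1) (hg.smul_section h2)]
  congr 1
  refine F.adapted_congr (F.contMDiffAt_adapted hU (hf.smul_section hW)).mdifferentiableAt_section
    (mdifferentiableAt_add_section (hfd.smul_section h1) (hg.smul_section h2)) ?_
  have hf1 : CMDiffAt 1 f x := hf.of_le (by norm_cast)
  filter_upwards [hW.eventually_mdifferentiableAt_section,
    (contMDiffAt_iff_contMDiffAt_nhds (by norm_num)).1 hf1] with y hy hfy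
  rw [F.adapted_smul (hfy.mdifferentiableAt one_ne_zero) hy]
  rfl

/-- After applying the Leibniz rule twice, the mixed first-order terms cancel by symmetry, and what
remains is `(UVf - VUf - [U, V]f) W = 0`. -/
theorem curvatureField_tensorial_right (F : Foliation E M n' n'') (hU : CMDiffAt ∞ (T% U) x)
    (hV : CMDiffAt ∞ (T% V) x) : SmoothTensorialAt (fun W => F.curvatureField U V W x) x where
  smul {f W} hf hW := by
    simp only [curvatureField]
    rw [F.adapted_adapted_smul hf hV hW, F.adapted_adapted_smul hf hU hW,
      F.adapted_smul (hf.mdifferentiableAt (by simp)) hW.mdifferentiableAt_section]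
    -- The second-order terms are multiples of `W x`. Either this vanishes, or `W` itself is the
    -- nonvanishing field that the commutator identity requires.
    by_cases h0 : W x = 0
    · simp only [h0]
      module
    · rw [← mvfderiv_mvfderiv_sub_mvfderiv_mvfderiv hf hU hV hW h0]
      module
  add {W W'} hW hW' := by
    simp only [curvatureField]
    rw [F.adapted_adapted_add hV hW hW', F.adapted_adapted_add hU hW hW',
      F.adapted_add hW.mdifferentiableAt_section hW'.mdifferentiableAt_section]
    simp only [add_apply]
    abel

/-- The extensions in the definition of `curvature` change with the base point, so its regularity in
`x` is not visible there. Tensoriality replaces them by the fields of one fixed frame. -/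
theorem curvature_eq_sum (F : Foliation E M n' n'') {ι : Type*} [Fintype ι]
    {s : ι → ∀ x : M, TangentSpace 𝓘(ℝ, E) x} {O : Set M} (hs : IsOrthonormalFrameOn s O)
    (hx : x ∈ O) (u v w : TangentSpace 𝓘(ℝ, E) x) :
    F.curvature x u v w = ∑ i, ∑ j, ∑ k,
      (inner ℝ (s i x) u * inner ℝ (s j x) v * inner ℝ (s k x) w : ℝ) •
        F.curvatureField (s i) (s j) (s k) x := by
  have hu := FiberBundle.contMDiffAt_extend (k := ∞) 𝓘(ℝ, E) E u
  have hv := FiberBundle.contMDiffAt_extend (k := ∞) 𝓘(ℝ, E) E v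
  have hw := FiberBundle.contMDiffAt_extend (k := ∞) 𝓘(ℝ, E) E w
  rw [curvature_eq_curvatureField, (F.curvatureField_tensorial_left hw).eq_sum hs hx hu]
  refine Finset.sum_congr rfl fun i _ => ?_
  rw [(F.curvatureField_tensorial_middle hw).eq_sum hs hx hv, Finset.smul_sum]
  refine Finset.sum_congr rfl fun j _ => ?_
  rw [(F.curvatureField_tensorial_right (hs.smooth x hx i) (hs.smooth x hx j)).eq_sum hs hx hw,
    Finset.smul_sum, Finset.smul_sum]
  refine Finset.sum_congr rfl fun k _ => ?_
  simp only [FiberBundle.extend_apply_self, smul_smul, mul_assoc]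

theorem torsion_eq_sum (F : Foliation E M n' n'') {ι : Type*} [Fintype ι]
    {s : ι → ∀ x : M, TangentSpace 𝓘(ℝ, E) x} {O : Set M} (hs : IsOrthonormalFrameOn s O)
    (hx : x ∈ O) (u v : TangentSpace 𝓘(ℝ, E) x) :
    F.torsion x u v = ∑ i, ∑ j, (inner ℝ (s i x) u * inner ℝ (s j x) v : ℝ) •
      F.torsion x (s i x) (s j x) := by
  conv_lhs => rw [hs.eq_sum hx u, hs.eq_sum hx v]
  simp only [map_sum, map_smul, sum_apply, smul_apply, smul_smul,
    Finset.smul_sum]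
  rw [Finset.sum_comm]
  simp only [mul_comm]

end Foliation

section Monomial

variable {ι : Type*} [Fintype ι]

/-- The multilinear map `u ↦ (∏ m, u m (I m)) • e l` on a Euclidean space. -/
def EuclideanSpace.multilinearMonomial {k : ℕ} (I : Fin k → ι) (l : ι) :
    ContinuousMultilinearMap ℝ (fun _ : Fin k => EuclideanSpace ℝ ι) (EuclideanSpace ℝ ι) :=
  ((ContinuousMultilinearMap.mkPiAlgebra ℝ (Fin k) ℝ).compContinuousLinearMap
    fun m => EuclideanSpace.proj (I m)).smulRight (EuclideanSpace.basisFun ι ℝ l)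

theorem EuclideanSpace.multilinearMonomial_apply {k : ℕ} (I : Fin k → ι) (l : ι)
    (u : Fin k → EuclideanSpace ℝ ι) :
    EuclideanSpace.multilinearMonomial I l u =
      (∏ m, u m (I m)) • EuclideanSpace.basisFun ι ℝ l :=
  rfl

end Monomial

/-! ### Continuity of the operator norms of torsion and curvature -/

namespace Foliation

variable {E : Type*} [NormedAddCommGroup E] [NormedSpace ℝ E] [FiniteDimensional ℝ E]
  {M : Type*} [TopologicalSpace M] [ChartedSpace E M] [IsManifold 𝓘(ℝ, E) ∞ M]
  [RiemannianBundle (fun x : M => TangentSpace 𝓘(ℝ, E) x)]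
  [IsContMDiffRiemannianBundle 𝓘(ℝ, E) ∞ E (fun x : M => TangentSpace 𝓘(ℝ, E) x)]
  {n' n'' : ℕ} {x : M} {ι : Type*} [Fintype ι]

/-- The torsion of the adapted connection in the coordinates of a frame. -/
def torsionCoord (F : Foliation E M n' n'') (s : ι → ∀ x : M, TangentSpace 𝓘(ℝ, E) x) (x : M) :
    ContinuousMultilinearMap ℝ (fun _ : Fin 2 => EuclideanSpace ℝ ι) (EuclideanSpace ℝ ι) :=
  ∑ i, ∑ j, ∑ l, (inner ℝ (s l x) (F.torsion x (s i x) (s j x)) : ℝ) •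
    EuclideanSpace.multilinearMonomial ![i, j] l

/-- The curvature of the adapted connection in the coordinates of a frame. -/
def curvatureCoord (F : Foliation E M n' n'') (s : ι → ∀ x : M, TangentSpace 𝓘(ℝ, E) x) (x : M) :
    ContinuousMultilinearMap ℝ (fun _ : Fin 3 => EuclideanSpace ℝ ι) (EuclideanSpace ℝ ι) :=
  ∑ i, ∑ j, ∑ k, ∑ l, (inner ℝ (s l x) (F.curvatureField (s i) (s j) (s k) x) : ℝ) •
    EuclideanSpace.multilinearMonomial ![i, j, k] l

variable {s : ι → ∀ x : M, TangentSpace 𝓘(ℝ, E) x} {O : Set M}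

theorem continuousAt_torsionCoord (F : Foliation E M n' n'') (hs : IsOrthonormalFrameOn s O)
    (hx : x ∈ O) : ContinuousAt (F.torsionCoord s) x := by
  refine tendsto_finsetSum _ fun i _ => tendsto_finsetSum _ fun j _ =>
    tendsto_finsetSum _ fun l _ => Tendsto.smul ?_ tendsto_const_nhds
  have h := hs.smooth x hx
  exact (contMDiffAt_inner (h l) (F.contMDiffAt_torsion (h i) (h j))).continuousAt

theorem continuousAt_curvatureCoord (F : Foliation E M n' n'') (hs : IsOrthonormalFrameOn s O)
    (hx : x ∈ O) : ContinuousAt (F.curvatureCoord s) x := by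
  refine tendsto_finsetSum _ fun i _ => tendsto_finsetSum _ fun j _ =>
    tendsto_finsetSum _ fun k _ => tendsto_finsetSum _ fun l _ =>
    Tendsto.smul ?_ tendsto_const_nhds
  have h := hs.smooth x hx
  exact (contMDiffAt_inner (h l) (F.contMDiffAt_curvatureField (h i) (h j) (h k))).continuousAt

theorem torsionCoord_repr (F : Foliation E M n' n'') (hs : IsOrthonormalFrameOn s O)
    (hx : x ∈ O) (u v : TangentSpace 𝓘(ℝ, E) x) :
    F.torsionCoord s x ![(hs.basis hx).repr u, (hs.basis hx).repr v] =
      (hs.basis hx).repr (F.torsion x u v) := by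
  rw [F.torsion_eq_sum hs hx u v]
  simp only [torsionCoord, sum_apply, smul_apply, EuclideanSpace.multilinearMonomial_apply,
    map_sum, map_smul, Fin.prod_univ_two, Matrix.cons_val_zero, Matrix.cons_val_one,
    OrthonormalBasis.repr_apply_apply, hs.basis_apply]
  refine Finset.sum_congr rfl fun i _ => Finset.sum_congr rfl fun j _ => ?_
  simp only [smul_comm _ (inner ℝ (s i x) u * inner ℝ (s j x) v), ← Finset.smul_sum]
  congr 1
  rw [← (EuclideanSpace.basisFun ι ℝ).sum_repr ((hs.basis hx).repr _)]
  simp [OrthonormalBasis.repr_apply_apply, hs.basis_apply]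

theorem curvatureCoord_repr (F : Foliation E M n' n'') (hs : IsOrthonormalFrameOn s O)
    (hx : x ∈ O) (u v w : TangentSpace 𝓘(ℝ, E) x) :
    F.curvatureCoord s x ![(hs.basis hx).repr u, (hs.basis hx).repr v, (hs.basis hx).repr w] =
      (hs.basis hx).repr (F.curvature x u v w) := by
  rw [F.curvature_eq_sum hs hx u v w]
  simp only [curvatureCoord, sum_apply, smul_apply, EuclideanSpace.multilinearMonomial_apply,
    map_sum, map_smul, Fin.prod_univ_three, Matrix.cons_val_zero, Matrix.cons_val_one,
    Matrix.cons_val, OrthonormalBasis.repr_apply_apply, hs.basis_apply]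
  refine Finset.sum_congr rfl fun i _ => Finset.sum_congr rfl fun j _ =>
    Finset.sum_congr rfl fun k _ => ?_
  simp only [smul_comm _ (inner ℝ (s i x) u * inner ℝ (s j x) v * inner ℝ (s k x) w),
    ← Finset.smul_sum]
  congr 1
  rw [← (EuclideanSpace.basisFun ι ℝ).sum_repr ((hs.basis hx).repr _)]
  simp [OrthonormalBasis.repr_apply_apply, hs.basis_apply]

/-- Frame coordinates are a linear isometry, so the admissible constants are those of a multilinear
map on a Euclidean space that does not depend on `x`. Hence the infimum is attained, and it is
locally the norm of a continuous family. -/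
theorem isLeast_torsionCoord (F : Foliation E M n' n'') (hs : IsOrthonormalFrameOn s O)
    (hx : x ∈ O) :
    IsLeast {c : ℝ | 0 ≤ c ∧ ∀ u v : TangentSpace 𝓘(ℝ, E) x,
      ‖F.torsion x u v‖ ≤ c * ‖u‖ * ‖v‖} ‖F.torsionCoord s x‖ := by
  convert (F.torsionCoord s x).isLeast_opNorm using 1
  ext c
  refine and_congr_right fun _ => ⟨fun h m => ?_, fun h u v => ?_⟩
  · obtain ⟨u, hu⟩ := (hs.basis hx).repr.surjective (m 0)
    obtain ⟨v, hv⟩ := (hs.basis hx).repr.surjective (m 1)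
    have hm : m = ![(hs.basis hx).repr u, (hs.basis hx).repr v] := by
      ext i : 1
      fin_cases i <;> simp [hu, hv]
    rw [hm, F.torsionCoord_repr hs hx]
    simpa [Fin.prod_univ_two, mul_assoc] using h u v
  · have := h ![(hs.basis hx).repr u, (hs.basis hx).repr v]
    rw [F.torsionCoord_repr hs hx] at this
    simpa [Fin.prod_univ_two, mul_assoc] using this

theorem isLeast_curvatureCoord (F : Foliation E M n' n'') (hs : IsOrthonormalFrameOn s O)
    (hx : x ∈ O) :
    IsLeast {c : ℝ | 0 ≤ c ∧ ∀ u v w : TangentSpace 𝓘(ℝ, E) x,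
      ‖F.curvature x u v w‖ ≤ c * ‖u‖ * ‖v‖ * ‖w‖} ‖F.curvatureCoord s x‖ := by
  convert (F.curvatureCoord s x).isLeast_opNorm using 1
  ext c
  refine and_congr_right fun _ => ⟨fun h m => ?_, fun h u v w => ?_⟩
  · obtain ⟨u, hu⟩ := (hs.basis hx).repr.surjective (m 0)
    obtain ⟨v, hv⟩ := (hs.basis hx).repr.surjective (m 1)
    obtain ⟨w, hw⟩ := (hs.basis hx).repr.surjective (m 2)
    have hm : m = ![(hs.basis hx).repr u, (hs.basis hx).repr v, (hs.basis hx).repr w] := by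
      ext i : 1
      fin_cases i <;> simp [hu, hv, hw]
    rw [hm, F.curvatureCoord_repr hs hx]
    simpa [Fin.prod_univ_three, mul_assoc] using h u v w
  · have := h ![(hs.basis hx).repr u, (hs.basis hx).repr v, (hs.basis hx).repr w]
    rw [F.curvatureCoord_repr hs hx] at this
    simpa [Fin.prod_univ_three, mul_assoc] using this

theorem norm_torsion_le (F : Foliation E M n' n'') (u v : TangentSpace 𝓘(ℝ, E) x) :
    ‖F.torsion x u v‖ ≤ F.torsionNorm x * ‖u‖ * ‖v‖ := by
  obtain ⟨s, O, hx, hs⟩ := exists_isOrthonormalFrameOn E x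
  have h := F.isLeast_torsionCoord hs hx
  rw [torsionNorm, h.csInf_eq]
  exact h.1.2 u v

theorem norm_curvature_le (F : Foliation E M n' n'') (u v w : TangentSpace 𝓘(ℝ, E) x) :
    ‖F.curvature x u v w‖ ≤ F.curvatureNorm x * ‖u‖ * ‖v‖ * ‖w‖ := by
  obtain ⟨s, O, hx, hs⟩ := exists_isOrthonormalFrameOn E x
  have h := F.isLeast_curvatureCoord hs hx
  rw [curvatureNorm, h.csInf_eq]
  exact h.1.2 u v w

theorem continuous_torsionNorm (F : Foliation E M n' n'') : Continuous F.torsionNorm := by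
  refine continuous_iff_continuousAt.2 fun x => ?_
  obtain ⟨s, O, hx, hs⟩ := exists_isOrthonormalFrameOn E x
  refine (F.continuousAt_torsionCoord hs hx).norm.congr ?_
  filter_upwards [hs.isOpen.mem_nhds hx] with y hy
  exact (F.isLeast_torsionCoord hs hy).csInf_eq.symm

theorem continuous_curvatureNorm (F : Foliation E M n' n'') : Continuous F.curvatureNorm := by
  refine continuous_iff_continuousAt.2 fun x => ?_
  obtain ⟨s, O, hx, hs⟩ := exists_isOrthonormalFrameOn E x
  refine (F.continuousAt_curvatureCoord hs hx).norm.congr ?_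
  filter_upwards [hs.isOpen.mem_nhds hx] with y hy
  exact (F.isLeast_curvatureCoord hs hy).csInf_eq.symm

end Foliation

/-! ### The covariant derivative along a curve in a local frame -/

namespace Foliation

variable {E : Type*} [NormedAddCommGroup E] [NormedSpace ℝ E] [FiniteDimensional ℝ E]
  {M : Type*} [TopologicalSpace M] [ChartedSpace E M] [IsManifold 𝓘(ℝ, E) ∞ M]
  [RiemannianBundle (fun x : M => TangentSpace 𝓘(ℝ, E) x)]
  [IsContMDiffRiemannianBundle 𝓘(ℝ, E) ∞ E (fun x : M => TangentSpace 𝓘(ℝ, E) x)]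
  {n' n'' : ℕ} {x : M} {ι : Type*} [Fintype ι]

theorem adapted_sum (F : Foliation E M n' n'') (c : ι → M → ℝ)
    (V : ι → ∀ x : M, TangentSpace 𝓘(ℝ, E) x) (hc : ∀ i, MDiffAt (c i) x)
    (hV : ∀ i, MDiffAt (T% (V i)) x) (v : TangentSpace 𝓘(ℝ, E) x) :
    F.adapted (fun y => ∑ i, c i y • V i y) x v =
      ∑ i, (c i x • F.adapted (V i) x v + mvfderiv 𝓘(ℝ, E) (c i) x v • V i x) := by
  classical
  have h (t : Finset ι) : F.adapted (fun y => ∑ i ∈ t, c i y • V i y) x v =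
      ∑ i ∈ t, (c i x • F.adapted (V i) x v + mvfderiv 𝓘(ℝ, E) (c i) x v • V i x) := by
    induction t using Finset.induction_on with
    | empty =>
      simp only [Finset.sum_empty]
      have := congrFun F.adapted.zero x
      exact congrArg (fun A => A v) this
    | insert i t hi ih =>
      simp only [Finset.sum_insert hi, ← ih]
      have h1 : MDiffAt (T% (c i • V i)) x := (hc i).smul_section (hV i)
      have h2 : MDiffAt (T% (fun y => ∑ i ∈ t, c i y • V i y)) x :=
        MDifferentiableAt.sum_section fun j _ => (hc j).smul_section (hV j)
      rw [← F.adapted_smul (hc i) (hV i), ← add_apply, ← F.adapted_add h1 h2]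
      rfl
  exact h Finset.univ

theorem extend_eq_symmL (v : TangentSpace 𝓘(ℝ, E) x) {y : M}
    (hy : y ∈ (trivializationAt E (fun x : M => TangentSpace 𝓘(ℝ, E) x) x).baseSet) :
    FiberBundle.extend E v y =
      (trivializationAt E (fun x : M => TangentSpace 𝓘(ℝ, E) x) x).symmL ℝ y
        ((trivializationAt E (fun x : M => TangentSpace 𝓘(ℝ, E) x) x) ⟨x, v⟩).2 :=
  (Trivialization.symmL_apply (R := ℝ) _ hy _).symm

theorem trivializationAt_snd_sum {y : M}
    (hy : y ∈ (trivializationAt E (fun x : M => TangentSpace 𝓘(ℝ, E) x) x).baseSet)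
    (c : ι → ℝ) (v : ι → TangentSpace 𝓘(ℝ, E) y) :
    ((trivializationAt E (fun x : M => TangentSpace 𝓘(ℝ, E) x) x) ⟨y, ∑ i, c i • v i⟩).2 =
      ∑ i, c i • ((trivializationAt E (fun x : M => TangentSpace 𝓘(ℝ, E) x) x) ⟨y, v i⟩).2 := by
  set e := trivializationAt E (fun x : M => TangentSpace 𝓘(ℝ, E) x) x
  have h (w : TangentSpace 𝓘(ℝ, E) y) : (e ⟨y, w⟩).2 = e.continuousLinearMapAt ℝ y w := by
    rw [Trivialization.continuousLinearMapAt_apply, Trivialization.linearMapAt_apply, if_pos hy]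
  simp only [h, map_sum, map_smul]

/-- The extensions are constant in the trivialization at `x`, hence near `x` they depend linearly on
the vector. -/
theorem adapted_extend_sum (F : Foliation E M n' n'') (c : ι → ℝ)
    (v : ι → TangentSpace 𝓘(ℝ, E) x) :
    F.adapted (FiberBundle.extend E (∑ i, c i • v i)) x =
      ∑ i, c i • F.adapted (FiberBundle.extend E (v i)) x := by
  have hx := FiberBundle.mem_baseSet_trivializationAt' (F := E)
    (E := fun x : M => TangentSpace 𝓘(ℝ, E) x) x
  have hv (i) := FiberBundle.mdifferentiableAt_extend 𝓘(ℝ, E) E (v i)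
  have h : ∀ᶠ y in 𝓝 x, FiberBundle.extend E (∑ i, c i • v i) y =
      ∑ i, c i • FiberBundle.extend E (v i) y := by
    filter_upwards [(trivializationAt E (fun x : M => TangentSpace 𝓘(ℝ, E) x)
      x).open_baseSet.mem_nhds hx] with y hy
    simp only [extend_eq_symmL _ hy, trivializationAt_snd_sum hx, map_sum, map_smul]
  ext w
  rw [F.adapted_congr (V := fun y => ∑ i, c i • FiberBundle.extend E (v i) y)
    (FiberBundle.mdifferentiableAt_extend 𝓘(ℝ, E) E _)
    (MDifferentiableAt.sum_section fun i _ => mdifferentiableAt_const.smul_section (hv i)) h,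
    F.adapted_sum (fun i _ => c i) _ (fun i => mdifferentiableAt_const) hv]
  simp [sum_apply, mvfderiv_const]

theorem mdifferentiableAt_trivializationAt_snd {V : ∀ x : M, TangentSpace 𝓘(ℝ, E) x}
    (hV : MDiffAt (T% V) x) :
    MDiffAt (fun y => ((trivializationAt E (fun x : M => TangentSpace 𝓘(ℝ, E) x) x)
      ⟨y, V y⟩).2) x :=
  (mdifferentiableAt_section 𝓘(ℝ, E) V).1 hV

/-- The covariant derivative in a trivialization is the derivative of the components plus the
covariant derivative of the field with constant components. -/
theorem adapted_eq_symmL_add (F : Foliation E M n' n'') {V : ∀ x : M, TangentSpace 𝓘(ℝ, E) x}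
    (hV : MDiffAt (T% V) x) (v : TangentSpace 𝓘(ℝ, E) x) :
    F.adapted V x v =
      (trivializationAt E (fun x : M => TangentSpace 𝓘(ℝ, E) x) x).symmL ℝ x
        (mvfderiv 𝓘(ℝ, E) (fun y => ((trivializationAt E (fun x : M => TangentSpace 𝓘(ℝ, E) x) x)
          ⟨y, V y⟩).2) x v)
      + F.adapted (FiberBundle.extend E (V x)) x v := by
  have hg := mdifferentiableAt_trivializationAt_snd hV
  set e := trivializationAt E (fun x : M => TangentSpace 𝓘(ℝ, E) x) x with he
  let b := Module.finBasis ℝ E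
  let l (k) : E →L[ℝ] ℝ := LinearMap.toContinuousLinearMap (b.coord k)
  have hl (w : E) : w = ∑ k, l k w • b k := (b.sum_repr w).symm
  let s (k) (y : M) : TangentSpace 𝓘(ℝ, E) y := e.symmL ℝ y (b k)
  have hx : x ∈ e.baseSet := FiberBundle.mem_baseSet_trivializationAt' x
  have hs (k) : MDiffAt (T% (s k)) x := by
    have h := FiberBundle.mdifferentiableAt_extend 𝓘(ℝ, E) E (e.symmL ℝ x (b k))
    refine h.congr_of_eventuallyEq ?_
    filter_upwards [e.open_baseSet.mem_nhds hx] with y hy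
    have h1 : (e ⟨x, e.symmL ℝ x (b k)⟩).2 = b k := by
      rw [Trivialization.symmL_apply (R := ℝ) e hx, Trivialization.apply_mk_symm e hx]
    rw [extend_eq_symmL _ hy]
    exact congrArg (fun w => (⟨y, e.symmL ℝ y w⟩ : TangentBundle 𝓘(ℝ, E) M)) h1.symm
  let c (k) (y : M) : ℝ := l k (e ⟨y, V y⟩).2
  have hc (k) : HasMFDerivAt 𝓘(ℝ, E) 𝓘(ℝ, ℝ) (c k) x ((l k).comp
      (mvfderiv 𝓘(ℝ, E) (fun y => (e ⟨y, V y⟩).2) x)) :=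
    HasMFDerivAt.comp x (g := l k) (I'' := 𝓘(ℝ, ℝ)) (l k).hasFDerivAt.hasMFDerivAt
      hg.hasMFDerivAt
  have hcV : ∀ᶠ y in 𝓝 x, V y = ∑ k, c k y • s k y := by
    filter_upwards [e.open_baseSet.mem_nhds hx] with y hy
    simp only [c, s, ← map_smul, ← map_sum, ← hl]
    rw [Trivialization.symmL_apply (R := ℝ) e hy, Trivialization.symm_apply_apply_mk e hy]
  have hcs : MDiffAt (T% (fun y => ∑ k, c k y • s k y)) x :=
    MDifferentiableAt.sum_section fun k _ => (hc k).mdifferentiableAt.smul_section (hs k)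
  -- The extension of `V x` has the coefficients of `V` frozen at `x`, so its covariant derivative
  -- differs from that of `V` exactly by the derivatives of the coefficients.
  have hext : ∀ᶠ y in 𝓝 x, FiberBundle.extend E (V x) y = ∑ k, c k x • s k y := by
    filter_upwards [e.open_baseSet.mem_nhds hx] with y hy
    rw [extend_eq_symmL _ hy]
    simp only [c, s, ← map_smul, ← map_sum, ← hl]
    rfl
  rw [F.adapted_congr hV hcs hcV, F.adapted_sum c s (fun k => (hc k).mdifferentiableAt) hs,
    F.adapted_congr (V := fun y => ∑ k, c k x • s k y)
      (FiberBundle.mdifferentiableAt_extend 𝓘(ℝ, E) E _)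
      (MDifferentiableAt.sum_section fun k _ => mdifferentiableAt_const.smul_section (hs k)) hext,
    F.adapted_sum (fun k _ => c k x) s (fun k => mdifferentiableAt_const) hs]
  rw [hl (mvfderiv 𝓘(ℝ, E) (fun y => (e ⟨y, V y⟩).2) x v)]
  have hd (k) : mvfderiv 𝓘(ℝ, E) (c k) x v =
      l k (mvfderiv 𝓘(ℝ, E) (fun y => (e ⟨y, V y⟩).2) x v) := by
    have := (hc k).mfderiv
    exact congrArg (fun A => A v) this
  simp only [hd, map_sum, map_smul, Finset.sum_add_distrib]
  simp [s, add_comm, mvfderiv_const]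
  rfl

section Along

variable {a b : ℝ} {γ : ℝ → M} {t : ℝ}

theorem hasDerivWithinAt_comp_curve (hγ : MDiffAt[Icc a b] γ t)
    {G : Type*} [NormedAddCommGroup G] [NormedSpace ℝ G] {g : M → G} (hg : MDiffAt g (γ t)) :
    HasDerivWithinAt (fun r => g (γ r))
      (mvfderiv 𝓘(ℝ, E) g (γ t) (velocity (E := E) a b γ t)) (Icc a b) t := by
  have h : HasFDerivWithinAt (fun r => g (γ r)) ((mvfderiv 𝓘(ℝ, E) g (γ t)).comp
      (mfderivWithin 𝓘(ℝ, ℝ) 𝓘(ℝ, E) γ (Icc a b) t)) (Icc a b) t :=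
    hasMFDerivWithinAt_iff_hasFDerivWithinAt.1
      (HasMFDerivAt.comp_hasMFDerivWithinAt t hg.hasMFDerivAt hγ.hasMFDerivWithinAt)
  exact h.hasDerivWithinAt

/-- The covariant derivative along a curve in terms of a local frame. -/
theorem covDerivAlong_eq_sum (F : Foliation E M n' n'') (hab : a < b) (ht : t ∈ Icc a b)
    (hγ : MDiffAt[Icc a b] γ t) {X : ∀ t, TangentSpace 𝓘(ℝ, E) (γ t)} {ξ : ι → ℝ → ℝ}
    {ξ' : ι → ℝ} {V : ι → ∀ x : M, TangentSpace 𝓘(ℝ, E) x}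
    (hξ : ∀ i, HasDerivWithinAt (ξ i) (ξ' i) (Icc a b) t)
    (hV : ∀ i, MDiffAt (T% (V i)) (γ t))
    (hX : ∀ᶠ r in 𝓝[Icc a b] t, X r = ∑ i, ξ i r • V i (γ r)) :
    F.covDerivAlong a b γ X t = ∑ i, (ξ' i • V i (γ t)
      + ξ i t • F.adapted (V i) (γ t) (velocity a b γ t)) := by
  -- Here `a < b` matters: on a single point `derivWithin` would not be determined.
  have hu : UniqueDiffWithinAt ℝ (Icc a b) t := uniqueDiffOn_Icc hab t ht
  have hXt : X t = ∑ i, ξ i t • V i (γ t) := hX.self_of_nhdsWithin ht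
  rw [covDerivAlong]
  set e := trivializationAt E (fun x : M => TangentSpace 𝓘(ℝ, E) x) (γ t) with he
  have hx : γ t ∈ e.baseSet := FiberBundle.mem_baseSet_trivializationAt' (γ t)
  have hg (i) := hasDerivWithinAt_comp_curve hγ (mdifferentiableAt_trivializationAt_snd (hV i))
  have heq : (fun r => (e ⟨γ r, X r⟩).2) =ᶠ[𝓝[Icc a b] t]
      fun r => ∑ i, ξ i r • (e ⟨γ r, V i (γ r)⟩).2 := by
    filter_upwards [hX, hγ.continuousWithinAt (e.open_baseSet.mem_nhds hx)] with r hr hbase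
    rw [hr]
    exact trivializationAt_snd_sum hbase _ _
  have hd := (HasDerivWithinAt.fun_sum (u := Finset.univ) fun i _ =>
    (hξ i).smul (hg i)).congr_of_eventuallyEq heq (heq.self_of_nhdsWithin ht)
  rw [hd.derivWithin hu, hXt, F.adapted_extend_sum]
  rw [← Trivialization.symmL_apply (R := ℝ) e hx]
  simp only [map_sum, map_add, map_smul, sum_apply, smul_apply, ← Finset.sum_add_distrib]
  refine Finset.sum_congr rfl fun i _ => ?_
  -- The derivative of the components of `V i` along `γ` and the term of its constant extension
  -- reassemble into `∇_γ' (V i)`.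
  rw [F.adapted_eq_symmL_add (hV i)]
  have h1 : e.symmL ℝ (γ t) (e ⟨γ t, V i (γ t)⟩).2 = V i (γ t) := by
    rw [Trivialization.symmL_apply (R := ℝ) e hx, Trivialization.symm_apply_apply_mk e hx]
  rw [h1]
  module

end Along

end Foliation

/-! ### Smooth vector fields along a curve -/

namespace Foliation

variable {E : Type*} [NormedAddCommGroup E] [NormedSpace ℝ E] [FiniteDimensional ℝ E]
  {M : Type*} [TopologicalSpace M] [ChartedSpace E M] [IsManifold 𝓘(ℝ, E) ∞ M]
  {a b : ℝ} {γ : ℝ → M} {t : ℝ} {X Y : ∀ t, TangentSpace 𝓘(ℝ, E) (γ t)}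

/-- A vector field along `γ : [a, b] → M` is smooth at `t`. -/
def SmoothAlongAt (a b : ℝ) (γ : ℝ → M) (X : ∀ t, TangentSpace 𝓘(ℝ, E) (γ t)) (t : ℝ) : Prop :=
  ContMDiffWithinAt 𝓘(ℝ, ℝ) 𝓘(ℝ, E).tangent ∞
    (fun t => (⟨γ t, X t⟩ : TangentBundle 𝓘(ℝ, E) M)) (Icc a b) t

theorem smoothAlongAt_iff :
    SmoothAlongAt a b γ X t ↔ CMDiffAt[Icc a b] ∞ γ t ∧
      ContDiffWithinAt ℝ ∞ (fun r => ((trivializationAt E (fun x : M => TangentSpace 𝓘(ℝ, E) x)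
        (γ t)) ⟨γ r, X r⟩).2) (Icc a b) t := by
  rw [← contMDiffWithinAt_iff_contDiffWithinAt]
  exact contMDiffWithinAt_totalSpace

namespace SmoothAlongAt

theorem curve (hX : SmoothAlongAt a b γ X t) : CMDiffAt[Icc a b] ∞ γ t :=
  (smoothAlongAt_iff.1 hX).1

theorem eventually_mem_baseSet (hγ : CMDiffAt[Icc a b] ∞ γ t) : ∀ᶠ r in 𝓝[Icc a b] t, γ r ∈
    (trivializationAt E (fun x : M => TangentSpace 𝓘(ℝ, E) x) (γ t)).baseSet :=
  hγ.continuousWithinAt ((trivializationAt E _ (γ t)).open_baseSet.mem_nhds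
    (FiberBundle.mem_baseSet_trivializationAt' (γ t)))

theorem comp_curve (hγ : CMDiffAt[Icc a b] ∞ γ t) {V : ∀ x : M, TangentSpace 𝓘(ℝ, E) x}
    (hV : CMDiffAt ∞ (T% V) (γ t)) : SmoothAlongAt a b γ (fun r => V (γ r)) t :=
  ContMDiffAt.comp_contMDiffWithinAt t hV hγ

theorem smul (hX : SmoothAlongAt a b γ X t) {f : ℝ → ℝ} (hf : ContDiffWithinAt ℝ ∞ f (Icc a b) t)
    (ht : t ∈ Icc a b) : SmoothAlongAt a b γ (fun r => f r • X r) t := by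
  obtain ⟨hγ, h⟩ := smoothAlongAt_iff.1 hX
  have heq : ∀ᶠ r in 𝓝[Icc a b] t,
      ((trivializationAt E (fun x : M => TangentSpace 𝓘(ℝ, E) x) (γ t)) ⟨γ r, f r • X r⟩).2 =
        f r • ((trivializationAt E (fun x : M => TangentSpace 𝓘(ℝ, E) x) (γ t)) ⟨γ r, X r⟩).2 := by
    filter_upwards [eventually_mem_baseSet hγ] with r hr
    exact (Trivialization.linear ℝ _ hr).map_smul _ _
  exact smoothAlongAt_iff.2 ⟨hγ, (hf.smul h).congr_of_eventuallyEq heq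
    (heq.self_of_nhdsWithin ht)⟩

theorem add (hX : SmoothAlongAt a b γ X t) (hY : SmoothAlongAt a b γ Y t) (ht : t ∈ Icc a b) :
    SmoothAlongAt a b γ (fun r => X r + Y r) t := by
  obtain ⟨hγ, h⟩ := smoothAlongAt_iff.1 hX
  have heq : ∀ᶠ r in 𝓝[Icc a b] t,
      ((trivializationAt E (fun x : M => TangentSpace 𝓘(ℝ, E) x) (γ t)) ⟨γ r, X r + Y r⟩).2 =
        ((trivializationAt E (fun x : M => TangentSpace 𝓘(ℝ, E) x) (γ t)) ⟨γ r, X r⟩).2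
        + ((trivializationAt E (fun x : M => TangentSpace 𝓘(ℝ, E) x) (γ t)) ⟨γ r, Y r⟩).2 := by
    filter_upwards [eventually_mem_baseSet hγ] with r hr
    exact (Trivialization.linear ℝ _ hr).map_add _ _
  exact smoothAlongAt_iff.2 ⟨hγ, (h.add (smoothAlongAt_iff.1 hY).2).congr_of_eventuallyEq heq
    (heq.self_of_nhdsWithin ht)⟩

theorem sub (hX : SmoothAlongAt a b γ X t) (hY : SmoothAlongAt a b γ Y t) (ht : t ∈ Icc a b) :
    SmoothAlongAt a b γ (fun r => X r - Y r) t := by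
  simpa [sub_eq_add_neg] using hX.add (hY.smul (f := fun _ => -1) contDiffWithinAt_const ht) ht

theorem congr (hX : SmoothAlongAt a b γ X t) (h : ∀ᶠ r in 𝓝[Icc a b] t, Y r = X r)
    (ht : t ∈ Icc a b) : SmoothAlongAt a b γ Y t :=
  ContMDiffWithinAt.congr_of_eventuallyEq hX (h.mono fun r hr => by simp only [hr])
    (by simp only [h.self_of_nhdsWithin ht])

theorem sum {ι : Type*} (s : Finset ι) {Z : ι → ∀ t, TangentSpace 𝓘(ℝ, E) (γ t)}
    (hγ : CMDiffAt[Icc a b] ∞ γ t) (hZ : ∀ i, SmoothAlongAt a b γ (Z i) t) (ht : t ∈ Icc a b) :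
    SmoothAlongAt a b γ (fun r => ∑ i ∈ s, Z i r) t := by
  classical
  induction s using Finset.induction_on with
  | empty =>
    simpa using comp_curve hγ (V := fun x => (0 : TangentSpace 𝓘(ℝ, E) x))
      (contMDiff_zeroSection ℝ (fun x : M => TangentSpace 𝓘(ℝ, E) x)).contMDiffAt
  | insert i s hi ih =>
    simp only [Finset.sum_insert hi]
    exact (hZ i).add ih ht

end SmoothAlongAt

theorem smoothAlongAt_velocity (hab : a < b) (hγ : CMDiff[Icc a b] ∞ γ) (ht : t ∈ Icc a b) :
    SmoothAlongAt (E := E) a b γ (velocity a b γ) t := by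
  -- The velocity is the tangent map of `γ` applied to the unit field of `ℝ`.
  have h1 := hγ.contMDiffOn_tangentMapWithin (m := ∞) (by simp)
    (uniqueDiffOn_Icc hab).uniqueMDiffOn
  have h2 : CMDiff ∞ (fun r : ℝ => (⟨r, (1 : ℝ)⟩ : TangentBundle 𝓘(ℝ, ℝ) ℝ)) :=
    contMDiff_vectorSpace_iff_contDiff.2 contDiff_const
  exact (h1.comp h2.contMDiffOn fun r hr => hr) t ht

variable [RiemannianBundle (fun x : M => TangentSpace 𝓘(ℝ, E) x)]
  [IsContMDiffRiemannianBundle 𝓘(ℝ, E) ∞ E (fun x : M => TangentSpace 𝓘(ℝ, E) x)]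
  {n' n'' : ℕ}

theorem SmoothAlongAt.contDiffWithinAt_inner (hX : SmoothAlongAt a b γ X t) (hY : SmoothAlongAt a b γ Y t) :
    ContDiffWithinAt ℝ ∞ (fun r => inner ℝ (X r) (Y r)) (Icc a b) t :=
  contMDiffWithinAt_iff_contDiffWithinAt.1 <|
    ContMDiffWithinAt.inner_bundle (IB := 𝓘(ℝ, E)) (F := E)
      (E := fun x : M => TangentSpace 𝓘(ℝ, E) x) (b := γ) hX hY

section Frame

variable {ι : Type*} [Fintype ι] {s : ι → ∀ x : M, TangentSpace 𝓘(ℝ, E) x} {O : Set M}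

theorem SmoothAlongAt.coeff (hX : SmoothAlongAt a b γ X t) (hs : IsOrthonormalFrameOn s O)
    (hO : γ t ∈ O) (i : ι) :
    ContDiffWithinAt ℝ ∞ (fun r => inner ℝ (s i (γ r)) (X r)) (Icc a b) t :=
  (SmoothAlongAt.comp_curve hX.curve (hs.smooth _ hO i)).contDiffWithinAt_inner hX

theorem eventually_mem_frame (hs : IsOrthonormalFrameOn s O) (hO : γ t ∈ O)
    (hγ : CMDiffAt[Icc a b] ∞ γ t) : ∀ᶠ r in 𝓝[Icc a b] t, γ r ∈ O :=
  hγ.continuousWithinAt (hs.isOpen.mem_nhds hO)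

/-- The covariant derivative along a curve in terms of an orthonormal frame. -/
theorem covDerivAlong_eq_sum_frame (F : Foliation E M n' n'') (hab : a < b) (ht : t ∈ Icc a b)
    (hs : IsOrthonormalFrameOn s O) (hO : γ t ∈ O) (hX : SmoothAlongAt a b γ X t) :
    F.covDerivAlong a b γ X t = ∑ i,
      (derivWithin (fun r => inner ℝ (s i (γ r)) (X r)) (Icc a b) t • s i (γ t)
      + (inner ℝ (s i (γ t)) (X t) : ℝ) •
        F.adapted (s i) (γ t) (velocity a b γ t)) := by
  refine F.covDerivAlong_eq_sum (ξ := fun i r => inner ℝ (s i (γ r)) (X r)) hab ht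
    (hX.curve.mdifferentiableWithinAt (by simp))
    (fun i => ((hX.coeff hs hO i).differentiableWithinAt (by simp)).hasDerivWithinAt)
    (fun i => (hs.smooth _ hO i).mdifferentiableAt_section) ?_
  filter_upwards [eventually_mem_frame hs hO hX.curve] with r hr using hs.eq_sum hr (X r)

/-- A smooth family of vectors that depends linearly on a smooth vector field along a curve
is smooth. -/
theorem SmoothAlongAt.tensor (hX : SmoothAlongAt a b γ X t) (ht : t ∈ Icc a b)
    (hs : IsOrthonormalFrameOn s O) (hO : γ t ∈ O)
    {A : ∀ r, TangentSpace 𝓘(ℝ, E) (γ r) →L[ℝ] TangentSpace 𝓘(ℝ, E) (γ r)}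
    (hA : ∀ i, SmoothAlongAt a b γ (fun r => A r (s i (γ r))) t) :
    SmoothAlongAt a b γ (fun r => A r (X r)) t := by
  refine (SmoothAlongAt.sum Finset.univ hX.curve
    (fun i => (hA i).smul (hX.coeff hs hO i) ht) ht).congr ?_ ht
  filter_upwards [eventually_mem_frame hs hO hX.curve] with r hr
  conv_lhs => rw [hs.eq_sum hr (X r)]
  simp only [map_sum, map_smul]

end Frame

theorem smoothAlongAt_torsion (F : Foliation E M n' n'') (hX : SmoothAlongAt a b γ X t)
    (hY : SmoothAlongAt a b γ Y t) (ht : t ∈ Icc a b) :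
    SmoothAlongAt a b γ (fun r => F.torsion (γ r) (X r) (Y r)) t := by
  obtain ⟨s, O, hO, hs⟩ := exists_isOrthonormalFrameOn E (γ t)
  refine hY.tensor (A := fun r => F.torsion (γ r) (X r)) ht hs hO fun j => ?_
  refine hX.tensor (A := fun r => (F.torsion (γ r)).flip (s j (γ r))) ht hs hO fun i => ?_
  exact SmoothAlongAt.comp_curve hX.curve
    (F.contMDiffAt_torsion (hs.smooth _ hO i) (hs.smooth _ hO j))

/-- By definition the derivative at each parameter uses its own trivialization. A frame around `γ t`
gives one formula valid at all nearby parameters, which is why smoothness of `X` is assumed on all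
of `[a, b]`. -/
theorem smoothAlongAt_covDerivAlong (F : Foliation E M n' n'') (hab : a < b)
    (hX : ∀ t ∈ Icc a b, SmoothAlongAt a b γ X t) (ht : t ∈ Icc a b) :
    SmoothAlongAt a b γ (F.covDerivAlong a b γ X) t := by
  obtain ⟨s, O, hO, hs⟩ := exists_isOrthonormalFrameOn E (γ t)
  have hγ : CMDiff[Icc a b] ∞ γ := fun r hr => (hX r hr).curve
  have hγt := hγ t ht
  have hd (i) : ContDiffWithinAt ℝ ∞
      (derivWithin (fun r => inner ℝ (s i (γ r)) (X r)) (Icc a b)) (Icc a b) t :=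
    ((hX t ht).coeff hs hO i).derivWithin (uniqueDiffOn_Icc hab) (by simp) ht
  refine (SmoothAlongAt.sum Finset.univ hγt (fun i =>
    ((SmoothAlongAt.comp_curve hγt (hs.smooth _ hO i)).smul (hd i) ht).add
      (SmoothAlongAt.smul ((smoothAlongAt_velocity hab hγ ht).tensor
        (A := fun r => F.adapted (s i) (γ r)) ht hs hO fun j => SmoothAlongAt.comp_curve hγt
          (F.contMDiffAt_adapted (hs.smooth _ hO j) (hs.smooth _ hO i)))
        ((hX t ht).coeff hs hO i) ht) ht) ht).congr ?_ ht
  filter_upwards [eventually_mem_frame hs hO hγt, self_mem_nhdsWithin] with r hrO hr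
  exact F.covDerivAlong_eq_sum_frame hab hr hs hrO (hX r hr)

theorem covDerivAlong_sub (F : Foliation E M n' n'') (hab : a < b) (ht : t ∈ Icc a b)
    (hX : SmoothAlongAt a b γ X t) (hY : SmoothAlongAt a b γ Y t) :
    F.covDerivAlong a b γ (fun r => X r - Y r) t =
      F.covDerivAlong a b γ X t - F.covDerivAlong a b γ Y t := by
  obtain ⟨s, O, hO, hs⟩ := exists_isOrthonormalFrameOn E (γ t)
  rw [F.covDerivAlong_eq_sum_frame hab ht hs hO (hX.sub hY ht),
    F.covDerivAlong_eq_sum_frame hab ht hs hO hX, F.covDerivAlong_eq_sum_frame hab ht hs hO hY,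
    ← Finset.sum_sub_distrib]
  refine Finset.sum_congr rfl fun i _ => ?_
  simp only [inner_sub_right]
  rw [derivWithin_fun_sub ((hX.coeff hs hO i).differentiableWithinAt (by simp))
    ((hY.coeff hs hO i).differentiableWithinAt (by simp))]
  module

/-- In an orthonormal frame `|X|² = ∑ xᵢ²`, so only the contribution `∑ xᵢ ∇sᵢ` of the moving frame
has to be shown orthogonal to `X`. -/
theorem hasDerivWithinAt_norm_sq_along (F : Foliation E M n' n'') (hab : a < b)
    (ht : t ∈ Icc a b) (hX : SmoothAlongAt a b γ X t) :
    HasDerivWithinAt (fun r => ‖X r‖ ^ 2) (2 * inner ℝ (X t) (F.covDerivAlong a b γ X t))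
      (Icc a b) t := by
  obtain ⟨s, O, hO, hs⟩ := exists_isOrthonormalFrameOn E (γ t)
  have hnorm {r : ℝ} (hr : γ r ∈ O) :
      ‖X r‖ ^ 2 = ∑ i, (inner ℝ (s i (γ r)) (X r) : ℝ) ^ 2 := by
    rw [← (hs.basis hr).sum_sq_norm_inner_right (X r)]
    simp [hs.basis_apply]
  have hd (i) := ((hX.coeff hs hO i).differentiableWithinAt (by simp)).hasDerivWithinAt
  have heq : (fun r => ‖X r‖ ^ 2) =ᶠ[𝓝[Icc a b] t]
      fun r => ∑ i, (inner ℝ (s i (γ r)) (X r) : ℝ) ^ 2 := by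
    filter_upwards [eventually_mem_frame hs hO hX.curve] with r hr using hnorm hr
  have key := (HasDerivWithinAt.fun_sum (u := Finset.univ) fun i _ =>
    (hd i).pow 2).congr_of_eventuallyEq heq (hnorm hO)
  refine key.congr_deriv ?_
  let v := velocity (E := E) a b γ t
  -- Freezing the coefficients at `t` gives a field of constant length near `γ t`; metric
  -- compatibility then makes its derivative orthogonal to it.
  let W : ∀ x : M, TangentSpace 𝓘(ℝ, E) x := fun x => ∑ i, (inner ℝ (s i (γ t)) (X t) : ℝ) • s i x
  have hsd (i) : MDiffAt (T% (s i)) (γ t) := (hs.smooth _ hO i).mdifferentiableAt_section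
  have hWX : W (γ t) = X t := (hs.eq_sum hO (X t)).symm
  have hW : MDiffAt (T% W) (γ t) :=
    MDifferentiableAt.sum_section fun i _ => mdifferentiableAt_const.smul_section (hsd i)
  have hWc : (fun y => (inner ℝ (W y) (W y) : ℝ)) =ᶠ[𝓝 (γ t)]
      fun _ => ∑ i, (inner ℝ (s i (γ t)) (X t) : ℝ) ^ 2 := by
    filter_upwards [hs.isOpen.mem_nhds hO] with y hy
    simp only [W, sum_inner, inner_sum, inner_smul_left, inner_smul_right,
      orthonormal_iff_ite.1 (hs.orthonormal y hy)]
    simp [pow_two]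
  have hWv : inner ℝ (X t) (F.adapted W (γ t) v) = (0 : ℝ) := by
    have h := F.adapted_metric (FiberBundle.mdifferentiableAt_extend 𝓘(ℝ, E) E v) hW hW
    have h0 : mvfderiv 𝓘(ℝ, E) (fun y => (inner ℝ (W y) (W y) : ℝ)) (γ t) = 0 := by
      rw [← mvfderiv_const (I := 𝓘(ℝ, E)) (∑ i, (inner ℝ (s i (γ t)) (X t) : ℝ) ^ 2)]
      exact hWc.mfderiv_eq
    rw [h0, FiberBundle.extend_apply_self, hWX, real_inner_comm] at h
    simp only [zero_apply] at h
    linarith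
  rw [F.adapted_sum (fun i _ => (inner ℝ (s i (γ t)) (X t) : ℝ)) s
    (fun i => mdifferentiableAt_const) hsd] at hWv
  rw [F.covDerivAlong_eq_sum_frame hab ht hs hO hX, Finset.sum_add_distrib, inner_add_right]
  simp only [mvfderiv_const, zero_apply, zero_smul, add_zero] at hWv
  rw [hWv, add_zero, inner_sum, Finset.mul_sum]
  refine Finset.sum_congr rfl fun i _ => ?_
  rw [inner_smul_right, real_inner_comm]
  simp
  ring

end Foliation

/-! ### The first-order system and the differential inequality -/

namespace Foliation

variable {E : Type*} [NormedAddCommGroup E] [NormedSpace ℝ E] [FiniteDimensional ℝ E]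
  {M : Type*} [TopologicalSpace M] [ChartedSpace E M] [IsManifold 𝓘(ℝ, E) ∞ M]
  [RiemannianBundle (fun x : M => TangentSpace 𝓘(ℝ, E) x)]
  [IsContMDiffRiemannianBundle 𝓘(ℝ, E) ∞ E (fun x : M => TangentSpace 𝓘(ℝ, E) x)]
  {n' n'' : ℕ} {a b : ℝ} {γ : ℝ → M} {t : ℝ} {X : ∀ t, TangentSpace 𝓘(ℝ, E) (γ t)}

theorem smoothAlongAt_jacobiY (F : Foliation E M n' n'') (hab : a < b)
    (hX : ∀ t ∈ Icc a b, SmoothAlongAt a b γ X t) (ht : t ∈ Icc a b) :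
    SmoothAlongAt a b γ (F.jacobiY a b γ X) t :=
  (F.smoothAlongAt_covDerivAlong hab hX ht).sub (F.smoothAlongAt_torsion
    (smoothAlongAt_velocity hab (fun r hr => (hX r hr).curve) ht) (hX t ht) ht) ht

/-- The terms `∇∇X` and `∇(T(γ', X))` of the Jacobi equation combine to `∇Y`, as both differentiated
fields are smooth along `γ`. -/
theorem IsAdaptedJacobiField.covDerivAlong_jacobiY {F : Foliation E M n' n''}
    (hX : F.IsAdaptedJacobiField a b γ X) (hab : a < b) (ht : t ∈ Icc a b) :
    F.covDerivAlong a b γ (F.jacobiY a b γ X) t =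
      F.curvature (γ t) (velocity a b γ t) (X t) (velocity a b γ t) := by
  have hs : ∀ t ∈ Icc a b, SmoothAlongAt a b γ X t := hX.smooth
  have h := F.covDerivAlong_sub hab ht (F.smoothAlongAt_covDerivAlong hab hs ht)
    (F.smoothAlongAt_torsion (smoothAlongAt_velocity hab (fun r hr => (hs r hr).curve) ht)
      (hs t ht) ht)
  have hJ := hX.jacobi t ht
  rw [sub_right_comm, ← h, sub_eq_zero] at hJ
  exact hJ

/-- The bound for the logarithmic derivative of `|X|² + |Y|²`. -/
theorem two_mul_inner_add_le {V : Type*} [NormedAddCommGroup V] [InnerProductSpace ℝ V]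
    {X Y T R : V} {τ ρ ν : ℝ} (hT : ‖T‖ ≤ τ * ν * ‖X‖) (hR : ‖R‖ ≤ ρ * ν * ‖X‖ * ν) :
    2 * inner ℝ X (Y + T) + 2 * inner ℝ Y R ≤
      (2 * τ ^ 2 * ν ^ 2 + 1 + ρ ^ 2 * ν ^ 4) * ‖X‖ ^ 2 + 3 * ‖Y‖ ^ 2 := by
  have h1 := real_inner_le_norm X (Y + T)
  have h2 := real_inner_le_norm Y R
  have h3 := norm_add_le Y T
  have hT2 : ‖T‖ ^ 2 ≤ (τ * ν * ‖X‖) ^ 2 := pow_le_pow_left₀ (norm_nonneg _) hT 2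
  have hR2 : ‖R‖ ^ 2 ≤ (ρ * ν * ‖X‖ * ν) ^ 2 := pow_le_pow_left₀ (norm_nonneg _) hR 2
  have hYT : ‖Y + T‖ ^ 2 ≤ (‖Y‖ + ‖T‖) ^ 2 := pow_le_pow_left₀ (norm_nonneg _) h3 2
  -- The squares give `2⟨X, Y + T⟩ ≤ |X|² + |Y + T|²`, `|Y + T|² ≤ 2|Y|² + 2|T|²` and `2⟨Y, R⟩ ≤
  -- |Y|² + |R|²`; the coefficient `3` of `|Y|²` is `2 + 1`.
  nlinarith [sq_nonneg (‖X‖ - ‖Y + T‖), sq_nonneg (‖Y‖ - ‖T‖), sq_nonneg (‖Y‖ - ‖R‖)]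

end Foliation

/-- A form of Grönwall's inequality. -/
theorem le_exp_mul_of_hasDerivWithinAt_le {a b C : ℝ} (hab : a ≤ b) {h h' : ℝ → ℝ}
    (hd : ∀ t ∈ Icc a b, HasDerivWithinAt h (h' t) (Icc a b) t)
    (hC : ∀ t ∈ Icc a b, h' t ≤ C * h t) : h b ≤ Real.exp (C * (b - a)) * h a := by
  have hexp (t : ℝ) : HasDerivAt (fun t => Real.exp (-C * t)) (Real.exp (-C * t) * -C) t := by
    simpa using ((hasDerivAt_id t).const_mul (-C)).exp
  have hg (t : ℝ) (ht : t ∈ Icc a b) := (hexp t).hasDerivWithinAt.mul (hd t ht)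
  -- The product `e^{-Ct} h` has derivative `e^{-Ct} (h' - C h) ≤ 0`; no sign of `h` or `C` is
  -- involved.
  have hanti : AntitoneOn (fun t => Real.exp (-C * t) * h t) (Icc a b) := by
    refine antitoneOn_of_hasDerivWithinAt_nonpos (convex_Icc a b)
      (fun t ht => (hg t ht).continuousWithinAt)
      (fun t ht => (hg t (interior_subset ht)).mono interior_subset) fun t ht => ?_
    have := mul_le_mul_of_nonneg_left (hC t (interior_subset ht)) (Real.exp_pos (-C * t)).le
    linarith
  have hle := hanti (left_mem_Icc.2 hab) (right_mem_Icc.2 hab) hab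
  have := mul_le_mul_of_nonneg_left hle (Real.exp_pos (C * b)).le
  simp only [← mul_assoc, ← Real.exp_add] at this
  have e₁ : C * b + -C * b = 0 := by ring
  have e₂ : C * b + -C * a = C * (b - a) := by ring
  rwa [e₁, e₂, Real.exp_zero, one_mul] at this

end

/-! ### The growth estimate -/

theorem proposition5p6
    {E : Type*} [NormedAddCommGroup E] [NormedSpace ℝ E] [FiniteDimensional ℝ E]
    {M : Type*} [TopologicalSpace M] [T2Space M] [SecondCountableTopology M]
    [ChartedSpace E M] [IsManifold 𝓘(ℝ, E) ∞ M]
    [RiemannianBundle (fun x : M => TangentSpace 𝓘(ℝ, E) x)]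
    [IsContMDiffRiemannianBundle 𝓘(ℝ, E) ∞ E (fun x : M => TangentSpace 𝓘(ℝ, E) x)]
    {n' n'' : ℕ} (F : Foliation E M n' n'') (hF : F.IsBundleLike)
    (a b : ℝ) (hab : a ≤ b)
    (γ : ℝ → M) (hγ : F.IsLeafwiseGeodesic a b γ)
    (X : ∀ t, TangentSpace 𝓘(ℝ, E) (γ t)) (hX : F.IsAdaptedJacobiField a b γ X) :
    ∃ C : ℝ,
      IsGreatest
        ((fun t => max 3
          (2 * F.torsionNorm (γ t) ^ 2 * ‖Foliation.velocity (E := E) a b γ t‖ ^ 2 + 1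
            + F.curvatureNorm (γ t) ^ 2 * ‖Foliation.velocity (E := E) a b γ t‖ ^ 4)) '' Icc a b) C ∧
      ‖X b‖ ^ 2 + ‖F.jacobiY a b γ X b‖ ^ 2
        ≤ Real.exp (C * (b - a)) * (‖X a‖ ^ 2 + ‖F.jacobiY a b γ X a‖ ^ 2) := by
  -- For `a = b` the maximum is over one point and the inequality is an equality, whatever values
  -- the derivatives within a point take.
  obtain rfl | hlt := hab.eq_or_lt
  · simp only [Icc_self, image_singleton, sub_self, mul_zero, Real.exp_zero,
      one_mul]
    exact ⟨_, isGreatest_singleton, le_rfl⟩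
  have hs : ∀ t ∈ Icc a b, Foliation.SmoothAlongAt a b γ X t := hX.smooth
  have hv (t) (ht : t ∈ Icc a b) := Foliation.smoothAlongAt_velocity (E := E) hlt hγ.smooth ht
  have hvc : ContinuousOn (fun t => ‖Foliation.velocity (E := E) a b γ t‖) (Icc a b) := by
    intro t ht
    simp only [norm_eq_sqrt_real_inner]
    exact ((hv t ht).contDiffWithinAt_inner (hv t ht)).continuousWithinAt.sqrt
  have hγc := hγ.smooth.continuousOn
  have hTc := F.continuous_torsionNorm.comp_continuousOn hγc
  have hRc := F.continuous_curvatureNorm.comp_continuousOn hγc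
  have hc : ContinuousOn (fun t => max 3
      (2 * F.torsionNorm (γ t) ^ 2 * ‖Foliation.velocity (E := E) a b γ t‖ ^ 2 + 1
        + F.curvatureNorm (γ t) ^ 2 * ‖Foliation.velocity (E := E) a b γ t‖ ^ 4)) (Icc a b) :=
    continuousOn_const.sup ((((continuousOn_const.mul (hTc.pow 2)).mul (hvc.pow 2)).add
      continuousOn_const).add ((hRc.pow 2).mul (hvc.pow 4)))
  obtain ⟨C, hC⟩ := (isCompact_Icc.image_of_continuousOn hc).exists_isGreatest
    ((nonempty_Icc.2 hab).image _)
  refine ⟨C, hC, ?_⟩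
  refine le_exp_mul_of_hasDerivWithinAt_le hab
    (h := fun t => ‖X t‖ ^ 2 + ‖F.jacobiY a b γ X t‖ ^ 2)
    (fun t ht => (F.hasDerivWithinAt_norm_sq_along hlt ht (hs t ht)).add
      (F.hasDerivWithinAt_norm_sq_along hlt ht (F.smoothAlongAt_jacobiY hlt hs ht)))
    fun t ht => ?_
  have hXY : F.covDerivAlong a b γ X t = F.jacobiY a b γ X t
      + F.torsion (γ t) (Foliation.velocity a b γ t) (X t) := by
    simp [Foliation.jacobiY]
  rw [hX.covDerivAlong_jacobiY hlt ht, hXY]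
  -- The two entries of the maximum bound the coefficients of `|Y|²` and `|X|²` separately.
  have hCt := max_le_iff.1 (hC.2 (mem_image_of_mem _ ht))
  refine (Foliation.two_mul_inner_add_le (F.norm_torsion_le _ _)
    (F.norm_curvature_le _ _ _)).trans ?_
  rw [mul_add]
  exact add_le_add (mul_le_mul_of_nonneg_right hCt.2 (sq_nonneg _))
    (mul_le_mul_of_nonneg_right hCt.1 (sq_nonneg _))
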